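/- Let $H$ be a real Hilbert space (for instance $H=L^2(\Omega)$ with $\Omega\subset\mathbb R^n$ open and bounded, with smooth boundary), and let $A$ be a self-adjoint, in general unbounded, operator on $H$ that is positive, i.e. $\langle Ax,x\rangle\ge 0$ for $x\in\operatorname{dom}A$, and has discrete spectrum, i.e. every point of its spectrum is isolated in the spectrum and is an eigenvalue of finite multiplicity. Let $E_\lambda$ be the resolution of the identity of $A$. For $s\ge 0$ put $$\mathcal H^s=\Big\{\varphi\in H:\ \|\varphi\|_s^2:=\int_0^\infty(1+\lambda^2)^s\,d\langle E_\lambda\varphi,\varphi\rangle<\infty\Big\},$$ let $\mathcal H^{-s}:=(\mathcal H^s)'$ be its dual with the dual norm, and identify $h\in H$ with the functional $\psi\mapsto\langle h,\psi\rangle$. Let $T>0$ and let $$V_e=\{u\in L^2(0,T;\mathcal H^1):\ (\partial_t^2-A^2)u=0\ \text{in}\ (0,T)\},$$ where the equation is understood in the sense of distributions (tested against $\eta(t)\psi$ with $\eta\in C_c^\infty(0,T)$ and $\psi\in\operatorname{dom}A^2$). For $u\in V_e$, the traces $u(0),u(T)\in\mathcal H^{1/2}$ and $\partial_tu(0),\partial_tu(T)\in\mathcal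 H^{-1/2}$ are the values at $0$ and $T$ of the continuous representatives $u\in C([0,T];\mathcal H^{1/2})$ and $\partial_tu\in C([0,T];\mathcal H^{-1/2})$. For data $(f,g)\in\mathcal H^{1/2}\times\mathcal H^{-1/2}$ consider the Cauchy problem: find $u\in V_e$ with $$(P_e)\qquad u(0)=f,\qquad \partial_tu(0)=g ;$$ it is called consistent for $(f,g)$ if it has a solution $u\in V_e$. Given any $\varphi_0\in\mathcal H^{-1/2}$, let $(\varphi_k)_{k\ge 0}\subset\mathcal H^{-1/2}$ be the elliptic iterates: for each $k\ge 0$, let $v\in V_e$ solve the mixed problem $v(0)=f$, $\partial_tv(T)=\varphi_k$, let $w\in V_e$ solve the mixed problem $\partial_tw(0)=g$, $w(T)=v(T)$, and put $\varphi_{k+1}:=\partial_tw(T)$. **Theorem.** If the sequence $\varphi_k$ converges in $\mathcal H^{-1/2}$, say to $\bar\varphi$, then problem $(P_e)$ is consistent for the data $(f,g)$, and its solution $u\in V_e$ satisfies $\partial_tu(T)=\bar\varphi$. -/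

import Mathlib

open MeasureTheory Set Filter Topology
open scoped ContDiff ENNReal

noncomputable section

namespace EllipticCauchy

variable {H : Type*} [NormedAddCommGroup H] [InnerProductSpace ℝ H]

/-! ### Unbounded operators: spectrum, eigenspaces, discrete spectrum -/

/-- The (real) resolvent set of the unbounded operator `A`: the real numbers `μ` for which
`A - μ : dom A → H` has an everywhere defined bounded two-sided inverse. -/
def resolventSet (A : H →ₗ.[ℝ] H) : Set ℝ :=
  {μ | ∃ R : H →L[ℝ] H,
    (∀ y : H, ∃ h : R y ∈ A.domain, A ⟨R y, h⟩ - μ • R y = y) ∧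
    ∀ x : A.domain, R (A x - μ • (x : H)) = x}

/-- The (real) spectrum of the unbounded operator `A`. -/
def spectrum (A : H →ₗ.[ℝ] H) : Set ℝ := (resolventSet A)ᶜ

/-- The eigenspace `ker (A - μ)`, a subspace of `H`. -/
def eigenspace (A : H →ₗ.[ℝ] H) (μ : ℝ) : Submodule ℝ H where
  carrier := {x | ∃ h : x ∈ A.domain, A ⟨x, h⟩ = μ • x}
  zero_mem' := ⟨A.domain.zero_mem, by
    have h0 : (⟨0, A.domain.zero_mem⟩ : A.domain) = 0 := rfl
    rw [h0, A.map_zero, smul_zero]⟩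
  add_mem' := by
    rintro x y ⟨hx, hAx⟩ ⟨hy, hAy⟩
    refine ⟨A.domain.add_mem hx hy, ?_⟩
    have h0 : (⟨x + y, A.domain.add_mem hx hy⟩ : A.domain) = ⟨x, hx⟩ + ⟨y, hy⟩ := rfl
    rw [h0, A.map_add, hAx, hAy, smul_add]
  smul_mem' := by
    rintro c x ⟨hx, hAx⟩
    refine ⟨A.domain.smul_mem c hx, ?_⟩
    have h0 : (⟨c • x, A.domain.smul_mem c hx⟩ : A.domain) = c • ⟨x, hx⟩ := rfl
    rw [h0, A.map_smul, hAx, smul_comm]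

/-- `A` has (purely) discrete spectrum: every point of the spectrum is isolated in the spectrum
and is an eigenvalue of finite multiplicity. -/
def HasDiscreteSpectrum (A : H →ₗ.[ℝ] H) : Prop :=
  ∀ μ ∈ spectrum A,
    (∃ ε : ℝ, 0 < ε ∧ ∀ ν ∈ spectrum A, |ν - μ| < ε → ν = μ) ∧
    eigenspace A μ ≠ ⊥ ∧ FiniteDimensional ℝ (eigenspace A μ)

/-- `A` is positive: `⟨A x, x⟩ ≥ 0` on the domain of `A`. -/
def IsPositive (A : H →ₗ.[ℝ] H) : Prop :=
  ∀ x : A.domain, 0 ≤ inner ℝ (A x) (x : H)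

variable [CompleteSpace H]

/-- The jump at `μ` of the resolution of the identity of `A`: the orthogonal projection onto
`ker (A - μ)` (which is closed for self-adjoint `A`; the closure is there only so that the
projection makes sense for every `A`). It is `0` when `μ` is not an eigenvalue. -/
def eigenProj (A : H →ₗ.[ℝ] H) (μ : ℝ) : H →L[ℝ] H :=
  (eigenspace A μ).topologicalClosure.starProjection

/-! ### The scale of spaces `ℋ^s` -/

/-- The family `((1 + μ²)^(s/2) P_μ φ)_μ`, where `P_μ` is the projection onto `ker (A - μ)`. -/
def weightedParts (A : H →ₗ.[ℝ] H) (s : ℝ) : H →ₗ[ℝ] PreLp (fun _ : ℝ => H) where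
  toFun φ := fun μ => (1 + μ ^ 2) ^ (s / 2) • eigenProj A μ φ
  map_add' x y := by
    funext μ
    change (1 + μ ^ 2) ^ (s / 2) • eigenProj A μ (x + y) =
      (1 + μ ^ 2) ^ (s / 2) • eigenProj A μ x + (1 + μ ^ 2) ^ (s / 2) • eigenProj A μ y
    rw [map_add, smul_add]
  map_smul' c x := by
    funext μ
    change (1 + μ ^ 2) ^ (s / 2) • eigenProj A μ (c • x) =
      c • (1 + μ ^ 2) ^ (s / 2) • eigenProj A μ x
    rw [map_smul, smul_comm]

/-- The subspace `ℋ^s = {φ ∈ H | ∫ (1 + λ²)^s d⟨E_λ φ, φ⟩ < ∞}` of `H`, for `s ≥ 0`. As the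
spectrum is discrete, the Stieltjes integral is the sum `∑_μ (1 + μ²)^s ‖P_μ φ‖²` over the jumps
of the resolution of the identity; the condition `φ = ∑_μ P_μ φ`, i.e. `φ = ∫ dE_λ φ`, holds for
every `φ ∈ H` when `A` is self-adjoint with discrete spectrum, and is recorded so that `‖·‖_s` is
a norm by definition. -/
def hsSubmodule (A : H →ₗ.[ℝ] H) (s : ℝ) : Submodule ℝ H where
  carrier := {φ | HasSum (fun μ : ℝ => eigenProj A μ φ) φ ∧ Memℓp (weightedParts A s φ) 2}
  zero_mem' := by
    refine ⟨by simp, ?_⟩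
    rw [map_zero]
    exact zero_memℓp
  add_mem' := by
    rintro x y ⟨hx, hx'⟩ ⟨hy, hy'⟩
    refine ⟨by simpa using hx.add hy, ?_⟩
    rw [map_add]
    exact hx'.add hy'
  smul_mem' := by
    rintro c x ⟨hx, hx'⟩
    refine ⟨by simpa using hx.const_smul c, ?_⟩
    rw [map_smul]
    exact hx'.const_smul c

/-- The space `ℋ^s`, as a type of its own because it carries the norm `‖·‖_s`, not that of `H`. -/
def Hs (A : H →ₗ.[ℝ] H) (s : ℝ) : Type _ := hsSubmodule A s

namespace Hs

variable {A : H →ₗ.[ℝ] H} {s : ℝ}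

instance : AddCommGroup (Hs A s) := inferInstanceAs (AddCommGroup (hsSubmodule A s))

instance : Module ℝ (Hs A s) := inferInstanceAs (Module ℝ (hsSubmodule A s))

/-- The inclusion of `ℋ^s` in `H`. -/
def toH : Hs A s →ₗ[ℝ] H := (hsSubmodule A s).subtype

/-- `φ ↦ ((1 + μ²)^(s/2) P_μ φ)_μ` as a map from `ℋ^s` to a Hilbert sum. -/
def parts : Hs A s →ₗ[ℝ] lp (fun _ : ℝ => H) 2 where
  toFun φ := ⟨weightedParts A s (toH φ), φ.2.2⟩
  map_add' x y := Subtype.ext ((weightedParts A s).map_add (toH x) (toH y))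
  map_smul' c x := Subtype.ext ((weightedParts A s).map_smul c (toH x))

theorem parts_injective : Function.Injective (parts (A := A) (s := s)) := by
  rw [injective_iff_map_eq_zero]
  intro φ hφ
  have h0 : ∀ μ : ℝ, eigenProj A μ (toH φ) = 0 := fun μ => by
    have h1 : (1 + μ ^ 2) ^ (s / 2) • eigenProj A μ (toH φ) = 0 :=
      congrArg (fun x : lp (fun _ : ℝ => H) 2 => x μ) hφ
    have h2 : (0 : ℝ) < (1 + μ ^ 2) ^ (s / 2) := Real.rpow_pos_of_pos (by positivity) _
    exact (smul_eq_zero.1 h1).resolve_left h2.ne'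
  have h3 : HasSum (fun μ : ℝ => eigenProj A μ (toH φ)) (toH φ) := φ.2.1
  simp only [h0] at h3
  exact Subtype.ext (h3.unique hasSum_zero)

/-- The norm `‖·‖_s` of `ℋ^s`; see `Hs.norm_sq`. -/
instance : NormedAddCommGroup (Hs A s) :=
  NormedAddCommGroup.induced (Hs A s) (lp (fun _ : ℝ => H) 2) (parts (A := A) (s := s))
    parts_injective

instance : NormedSpace ℝ (Hs A s) :=
  NormedSpace.induced ℝ (Hs A s) (lp (fun _ : ℝ => H) 2) (parts (A := A) (s := s))

/-- `‖φ‖_s² = ∑_μ (1 + μ²)^s ‖P_μ φ‖²`, i.e. `∫ (1 + λ²)^s d⟨E_λ φ, φ⟩`. -/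
theorem norm_sq (φ : Hs A s) :
    ‖φ‖ ^ 2 = ∑' μ : ℝ, (1 + μ ^ 2) ^ s * ‖eigenProj A μ (toH φ)‖ ^ 2 := by
  have h : ‖φ‖ = ‖parts φ‖ := rfl
  have h2 := lp.norm_rpow_eq_tsum (p := 2) (by norm_num) (parts φ)
  simp only [ENNReal.toReal_ofNat, Real.rpow_ofNat] at h2
  rw [h, h2]
  refine tsum_congr fun μ => ?_
  have h3 : (parts φ : lp (fun _ : ℝ => H) 2) μ =
      (1 + μ ^ 2) ^ (s / 2) • eigenProj A μ (toH φ) := rfl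
  have h4 : (0 : ℝ) ≤ 1 + μ ^ 2 := by positivity
  rw [h3, norm_smul, mul_pow, Real.norm_of_nonneg (Real.rpow_nonneg h4 _), ← Real.rpow_natCast,
    ← Real.rpow_mul h4]
  norm_num

end Hs

/-- `ℋ^{-s}`, the dual of `ℋ^s`, with the dual norm. An `h ∈ H` is identified with the functional
`ψ ↦ ⟨h, ψ⟩`. -/
abbrev HsNeg (A : H →ₗ.[ℝ] H) (s : ℝ) : Type _ := StrongDual ℝ (Hs A s)

/-! ### The solution space and its traces -/

/-- `η` is a test function on the open interval `(0, T)`. -/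
def IsTest (T : ℝ) (η : ℝ → ℝ) : Prop :=
  ContDiff ℝ ∞ η ∧ HasCompactSupport η ∧ tsupport η ⊆ Ioo 0 T

/-- `u ∈ V_e`: `u ∈ L²(0, T; ℋ¹)` and `(∂_t² - A²) u = 0` in `(0, T)` in the sense of
distributions, i.e. tested against `η(t) ψ` with `η ∈ C_c^∞(0, T)` and `ψ ∈ dom (A²)`. -/
def MemVe (A : H →ₗ.[ℝ] H) (T : ℝ) (u : ℝ → Hs A 1) : Prop :=
  MemLp u 2 (volume.restrict (Ioo 0 T)) ∧
  ∀ η : ℝ → ℝ, IsTest T η → ∀ (ψ : A.domain) (hψ : A ψ ∈ A.domain),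
    ∫ t in Ioo 0 T, iteratedDeriv 2 η t * inner ℝ (Hs.toH (u t)) (ψ : H) =
      ∫ t in Ioo 0 T, η t * inner ℝ (Hs.toH (u t)) (A ⟨A ψ, hψ⟩)

/-- The trace `u(t₀) = f` in `ℋ^{1/2}`, for `t₀ ∈ [0, T]`: `u` agrees almost everywhere with a
continuous function `[0, T] → ℋ^{1/2}` whose value at `t₀` is `f`. -/
def HasTrace (A : H →ₗ.[ℝ] H) (T : ℝ) (u : ℝ → Hs A 1) (t₀ : ℝ) (f : Hs A (1 / 2)) : Prop :=
  ∃ U : ℝ → Hs A (1 / 2), ContinuousOn U (Icc 0 T) ∧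
    (∀ᵐ t ∂(volume.restrict (Ioo 0 T)), Hs.toH (U t) = Hs.toH (u t)) ∧ U t₀ = f

/-- The trace `∂_t u(t₀) = g` in `ℋ^{-1/2}`, for `t₀ ∈ [0, T]`: the distributional derivative
`∂_t u` is a continuous function `[0, T] → ℋ^{-1/2}` whose value at `t₀` is `g`. -/
def HasDerivTrace (A : H →ₗ.[ℝ] H) (T : ℝ) (u : ℝ → Hs A 1) (t₀ : ℝ) (g : HsNeg A (1 / 2)) :
    Prop :=
  ∃ p : ℝ → HsNeg A (1 / 2), ContinuousOn p (Icc 0 T) ∧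
    (∀ η : ℝ → ℝ, IsTest T η → ∀ ψ : Hs A (1 / 2),
      ∫ t in Ioo 0 T, deriv η t * inner ℝ (Hs.toH (u t)) (Hs.toH ψ) =
        -∫ t in Ioo 0 T, η t * p t ψ) ∧
    p t₀ = g

/-! ### The Cauchy problem and the iteration -/

/-- `u ∈ V_e` solves the elliptic Cauchy problem
`(∂_t² - A²) u = 0`, `u(0) = f`, `∂_t u(0) = g`. -/
def SolvesCauchy (A : H →ₗ.[ℝ] H) (T : ℝ) (f : Hs A (1 / 2)) (g : HsNeg A (1 / 2))
    (u : ℝ → Hs A 1) : Prop :=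
  MemVe A T u ∧ HasTrace A T u 0 f ∧ HasDerivTrace A T u 0 g

/-- The Cauchy problem is consistent for the data `(f, g)`: it has a solution in `V_e`. -/
def IsConsistent (A : H →ₗ.[ℝ] H) (T : ℝ) (f : Hs A (1 / 2)) (g : HsNeg A (1 / 2)) : Prop :=
  ∃ u : ℝ → Hs A 1, SolvesCauchy A T f g u

/-- One step `φ ↦ φ'` of the iteration: `v ∈ V_e` solves the mixed problem `v(0) = f`,
`∂_t v(T) = φ`; then `w ∈ V_e` solves the mixed problem `∂_t w(0) = g`, `w(T) = v(T)`; and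
`φ' = ∂_t w(T)`. -/
def IsStep (A : H →ₗ.[ℝ] H) (T : ℝ) (f : Hs A (1 / 2)) (g : HsNeg A (1 / 2))
    (φ φ' : HsNeg A (1 / 2)) : Prop :=
  ∃ (v w : ℝ → Hs A 1) (h : Hs A (1 / 2)),
    (MemVe A T v ∧ HasTrace A T v 0 f ∧ HasDerivTrace A T v T φ) ∧
    HasTrace A T v T h ∧
    (MemVe A T w ∧ HasDerivTrace A T w 0 g ∧ HasTrace A T w T h) ∧
    HasDerivTrace A T w T φ'

/-- `(φ_k)` is a sequence of elliptic iterates for the data `(f, g)`, with arbitrary initial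
guess `φ_0 ∈ ℋ^{-1/2}`. -/
def IsIterate (A : H →ₗ.[ℝ] H) (T : ℝ) (f : Hs A (1 / 2)) (g : HsNeg A (1 / 2))
    (φ : ℕ → HsNeg A (1 / 2)) : Prop :=
  ∀ k : ℕ, IsStep A T f g (φ k) (φ (k + 1))

end EllipticCauchy

end

/-! Test an element `u` of V_e on an eigenvector ψ with eigenvalue μ. The scalar function Y = ⟨u, ψ⟩
satisfies Y'' = μ²Y, so (Y', μY) at `T` is the hyperbolic rotation through μT of its value at 0
(`MemVe.cauchy_data`). Eliminating the common value v(T) = w(T) from the two mixed problems gives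
the scalar recursion cosh² φ' = cosh g + μ sinh f + sinh² φ, everything paired with ψ and taken at
μT (`IsStep.apply_eigenvector`). Since cosh² - sinh² = 1, a limit must satisfy φbar = cosh g + μ
sinh f (`limit_apply_eigenvector`), which is the value of Y' at `T` that the Cauchy data (f, g)
dictate.

Convergence matters because it places this formal final slope in ℋ^{-1/2}. The mixed problem u(0) =
f, ∂_t u(T) = φbar is solvable for all such data (`exists_mixed_solution`), and its slope at 0
agrees with g on every eigenvector, hence equals g (`Hs.functional_ext`). Any other solution of the
Cauchy problem has slope φbar at `T` by the same relations.

Solvability rests on explicit coefficients: one summable majorant, `mixedBound`, controls the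
solution in C([0,T]; ℋ^{1/2}), its derivative in C([0,T]; ℋ^{-1/2}), and the solution in L²(0,T;
ℋ¹). The eigenvector expansion of elements of ℋ^s is part of the definition of `hsSubmodule`, so no
spectral theorem is needed. -/

noncomputable section

namespace EllipticCauchy

/-! ### Eigenspaces of self-adjoint operators with discrete spectrum -/

section Eigenspaces

variable {H : Type*} [NormedAddCommGroup H] [InnerProductSpace ℝ H]

/-- The eigenspaces of `A` are closed and pairwise orthogonal. -/
structure OrthogonalEigenspaces (A : H →ₗ.[ℝ] H) : Prop where
  isClosed : ∀ μ, IsClosed (eigenspace A μ : Set H)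
  orthogonal : OrthogonalFamily ℝ (fun μ => eigenspace A μ) fun μ => (eigenspace A μ).subtypeₗᵢ

/-- On the spectrum the eigenspace is finite-dimensional; off it, a left inverse of A - μ makes it
trivial. -/
theorem HasDiscreteSpectrum.isClosed_eigenspace {A : H →ₗ.[ℝ] H} (hA : HasDiscreteSpectrum A)
    (μ : ℝ) : IsClosed (eigenspace A μ : Set H) := by
  by_cases hμ : μ ∈ spectrum A
  · have := (hA μ hμ).2.2
    exact Submodule.closed_of_finiteDimensional _
  · obtain ⟨R, -, hR⟩ := not_not.1 hμ
    have h0 : eigenspace A μ = ⊥ := by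
      refine (Submodule.eq_bot_iff _).2 ?_
      rintro x ⟨hx, hAx⟩
      have := hR ⟨x, hx⟩
      simpa [hAx] using this.symm
    rw [h0]
    simp

variable [CompleteSpace H]

theorem inner_apply_left_of_isSelfAdjoint {A : H →ₗ.[ℝ] H} (hA : IsSelfAdjoint A)
    (x y : A.domain) : inner ℝ (A x) (y : H) = inner ℝ (x : H) (A y) := by
  have h := LinearPMap.adjoint_isFormalAdjoint (T := A) hA.dense_domain
  rw [LinearPMap.isSelfAdjoint_def.1 hA] at h
  exact h x y

theorem orthogonalEigenspaces {A : H →ₗ.[ℝ] H} (hA : IsSelfAdjoint A)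
    (hd : HasDiscreteSpectrum A) : OrthogonalEigenspaces A where
  isClosed := hd.isClosed_eigenspace
  orthogonal := by
    rintro μ ν hμν ⟨x, hx, hAx⟩ ⟨y, hy, hAy⟩
    have h := inner_apply_left_of_isSelfAdjoint hA ⟨x, hx⟩ ⟨y, hy⟩
    rw [hAx, hAy, real_inner_smul_left, real_inner_smul_right] at h
    have : (μ - ν) * inner ℝ x y = 0 := by simp only at h; linarith
    exact (mul_eq_zero.1 this).resolve_left (sub_ne_zero.2 hμν)

variable {A : H →ₗ.[ℝ] H}

theorem inner_eigenProj_left (μ : ℝ) (x y : H) :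
    inner ℝ (eigenProj A μ x) y = inner ℝ x (eigenProj A μ y) :=
  Submodule.inner_starProjection_left_eq_right _ _ _

namespace OrthogonalEigenspaces

theorem eigenProj_mem (hA : OrthogonalEigenspaces A) (μ : ℝ) (x : H) : eigenProj A μ x ∈ eigenspace A μ := by
  have h : eigenProj A μ x ∈ (eigenspace A μ).topologicalClosure :=
    Submodule.starProjection_apply_mem _ _
  rwa [(hA.isClosed μ).submodule_topologicalClosure_eq] at h

theorem eigenProj_eq_self {μ : ℝ} {x : H} (hx : x ∈ eigenspace A μ) : eigenProj A μ x = x :=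
  Submodule.starProjection_eq_self_iff.2 (Submodule.le_topologicalClosure _ hx)

theorem eigenProj_eigenProj (μ : ℝ) (x : H) :
    eigenProj A μ (eigenProj A μ x) = eigenProj A μ x :=
  Submodule.starProjection_eq_self_iff.2 (Submodule.starProjection_apply_mem _ _)

theorem eigenProj_eq_zero (hA : OrthogonalEigenspaces A) {μ ν : ℝ} (h : ν ≠ μ) {x : H} (hx : x ∈ eigenspace A μ) :
    eigenProj A ν x = 0 := by
  rw [← inner_self_eq_zero (𝕜 := ℝ)]
  have h1 := hA.eigenProj_mem ν x
  rw [inner_eigenProj_left, eigenProj_eq_self h1]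
  have := hA.orthogonal h.symm ⟨x, hx⟩ ⟨_, h1⟩
  simpa using this

/-- Square summable families of eigenvectors have a sum, with the expected components. -/
theorem exists_hasSum (hA : OrthogonalEigenspaces A) {a : ℝ → H} (ha : ∀ μ, a μ ∈ eigenspace A μ)
    (hs : Summable fun μ => ‖a μ‖ ^ 2) :
    ∃ x : H, HasSum a x ∧ ∀ μ, eigenProj A μ x = a μ := by
  have h1 : Summable a :=
    (hA.orthogonal.summable_iff_norm_sq_summable fun μ => (⟨a μ, ha μ⟩ : eigenspace A μ)).2 hs
  obtain ⟨x, hx⟩ := h1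
  refine ⟨x, hx, fun μ => ?_⟩
  have h2 := hx.mapL (eigenProj A μ)
  refine h2.unique ?_
  convert hasSum_single μ fun ν hν => ?_
  · exact (eigenProj_eq_self (ha μ)).symm
  · exact hA.eigenProj_eq_zero hν.symm (ha ν)

/-- Bessel's inequality: a finite partial sum y satisfies ⟨y, x⟩ = ‖y‖², so Cauchy–Schwarz gives ‖y‖
≤ ‖x‖. -/
theorem summable_norm_sq_eigenProj (hA : OrthogonalEigenspaces A) (x : H) : Summable fun μ => ‖eigenProj A μ x‖ ^ 2 := by
  refine summable_of_sum_le (c := ‖x‖ ^ 2) (fun _ => by positivity) fun s => ?_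
  have h1 := hA.orthogonal.norm_sum
    (fun μ => (⟨eigenProj A μ x, hA.eigenProj_mem μ x⟩ : eigenspace A μ)) s
  change ‖∑ μ ∈ s, eigenProj A μ x‖ ^ 2 = ∑ μ ∈ s, ‖eigenProj A μ x‖ ^ 2 at h1
  set y := ∑ μ ∈ s, eigenProj A μ x with hy
  have h2 : inner ℝ y x = ‖y‖ ^ 2 := by
    rw [h1, hy, sum_inner]
    refine Finset.sum_congr rfl fun μ _ => ?_
    rw [← real_inner_self_eq_norm_sq, inner_eigenProj_left, inner_eigenProj_left,
      eigenProj_eq_self (hA.eigenProj_mem μ x)]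
  have h3 := real_inner_le_norm y x
  rw [h2] at h3
  rcases (norm_nonneg y).eq_or_lt with h | h
  · rw [← h1, ← h]; simp
  · rw [← h1]
    have : ‖y‖ ≤ ‖x‖ := by
      rw [pow_two] at h3; exact le_of_mul_le_mul_left h3 h
    gcongr

end OrthogonalEigenspaces

end Eigenspaces

/-! ### The scale `ℋ^s` inside the Hilbert sum -/

namespace Hs

theorem norm_rpow_smul_sq {H : Type*} [NormedAddCommGroup H] [NormedSpace ℝ H] (μ r : ℝ) (x : H) :
    ‖(1 + μ ^ 2) ^ (r / 2) • x‖ ^ 2 = (1 + μ ^ 2) ^ r * ‖x‖ ^ 2 := by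
  have h4 : (0 : ℝ) ≤ 1 + μ ^ 2 := by positivity
  rw [norm_smul, mul_pow, Real.norm_of_nonneg (Real.rpow_nonneg h4 _), ← Real.rpow_natCast,
    ← Real.rpow_mul h4]
  norm_num

theorem memℓp_two_iff {H : Type*} [NormedAddCommGroup H] {ι : Type*} {a : ι → H} :
    Memℓp a 2 ↔ Summable fun i => ‖a i‖ ^ 2 := by
  rw [memℓp_gen_iff (by norm_num)]
  simp

variable {H : Type*} [NormedAddCommGroup H] [InnerProductSpace ℝ H] [CompleteSpace H]
  {A : H →ₗ.[ℝ] H} {s : ℝ}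

theorem parts_apply (φ : Hs A s) (μ : ℝ) :
    (parts φ : ℝ → H) μ = (1 + μ ^ 2) ^ (s / 2) • eigenProj A μ (toH φ) := rfl

/-- `parts` as a linear isometry. -/
def partsLI : Hs A s →ₗᵢ[ℝ] lp (fun _ : ℝ => H) 2 where
  toLinearMap := parts
  norm_map' _ := rfl

theorem partsLI_apply (φ : Hs A s) : partsLI φ = parts φ := rfl

theorem toH_eq_of_eigenProj {s' : ℝ} {φ : Hs A s} {ψ : Hs A s'}
    (h : ∀ μ, eigenProj A μ (toH φ) = eigenProj A μ (toH ψ)) : toH φ = toH ψ := by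
  have h1 : HasSum (fun μ : ℝ => eigenProj A μ (toH φ)) (toH φ) := φ.2.1
  have h2 : HasSum (fun μ : ℝ => eigenProj A μ (toH ψ)) (toH ψ) := ψ.2.1
  simp only [h] at h1
  exact h1.unique h2

theorem ext_eigenProj {φ ψ : Hs A s}
    (h : ∀ μ, eigenProj A μ (toH φ) = eigenProj A μ (toH ψ)) : φ = ψ :=
  Subtype.ext (toH_eq_of_eigenProj h)

theorem hasSum_inner (φ : Hs A s) (x : H) :
    HasSum (fun μ => inner ℝ (eigenProj A μ (toH φ)) (eigenProj A μ x)) (inner ℝ (toH φ) x) := by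
  have h1 : HasSum (fun μ : ℝ => eigenProj A μ (toH φ)) (toH φ) := φ.2.1
  have h2 := h1.mapL (innerSL ℝ x)
  simp only [innerSL_apply_apply] at h2
  rw [real_inner_comm]
  refine h2.congr_fun fun μ => ?_
  rw [← inner_eigenProj_left, real_inner_comm, OrthogonalEigenspaces.eigenProj_eigenProj]

theorem summable_parts (φ : Hs A s) :
    Summable fun μ : ℝ => (1 + μ ^ 2) ^ s * ‖eigenProj A μ (toH φ)‖ ^ 2 := by
  have h := memℓp_two_iff.1 φ.2.2
  refine h.congr fun μ => ?_
  exact norm_rpow_smul_sq μ s _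

/-- The element of `ℋ^s` with prescribed components in the eigenspaces. -/
theorem exists_eigenProj_eq (hA : OrthogonalEigenspaces A) (hs : 0 ≤ s) {a : ℝ → H}
    (ha : ∀ μ, a μ ∈ eigenspace A μ)
    (hsum : Summable fun μ : ℝ => (1 + μ ^ 2) ^ s * ‖a μ‖ ^ 2) :
    ∃ φ : Hs A s, ∀ μ, eigenProj A μ (toH φ) = a μ := by
  obtain ⟨x, hx, hxa⟩ := hA.exists_hasSum ha <| hsum.of_nonneg_of_le (fun _ => by positivity)
    fun μ => le_mul_of_one_le_left (by positivity)
      (Real.one_le_rpow (by nlinarith [sq_nonneg μ]) hs)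
  refine ⟨⟨x, ?_, ?_⟩, hxa⟩
  · simpa only [hxa] using hx
  · refine memℓp_two_iff.2 ?_
    refine hsum.congr fun μ => ?_
    rw [← hxa μ]
    exact (norm_rpow_smul_sq μ s _).symm

/-- Only one component is nonzero, so the weighted sum is finite. This makes eigenvectors available
as test elements. -/
theorem exists_toH_eq (hA : OrthogonalEigenspaces A) (hs : 0 ≤ s) {μ : ℝ} {x : H}
    (hx : x ∈ eigenspace A μ) : ∃ φ : Hs A s, toH φ = x := by
  obtain ⟨φ, hφ⟩ := exists_eigenProj_eq hA hs (a := fun ν => eigenProj A ν x)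
    (fun ν => hA.eigenProj_mem ν x) <| summable_of_ne_finset_zero (s := {μ}) fun ν hν => by
      rw [hA.eigenProj_eq_zero (by simpa using hν) hx]; simp
  refine ⟨φ, ?_⟩
  have h1 : HasSum (fun ν : ℝ => eigenProj A ν (toH φ)) (toH φ) := φ.2.1
  simp only [hφ] at h1
  refine h1.unique ?_
  convert hasSum_single μ fun ν hν => hA.eigenProj_eq_zero hν hx
  exact (OrthogonalEigenspaces.eigenProj_eq_self hx).symm

/-- Functionals on `ℋ^s` that agree on eigenvectors are equal. -/
theorem functional_ext (hA : OrthogonalEigenspaces A) (hs : 0 ≤ s) {p q : HsNeg A s}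
    (h : ∀ (μ : ℝ) (φ : Hs A s), toH φ ∈ eigenspace A μ → p φ = q φ) : p = q := by
  ext ψ
  choose e he using fun μ => exists_toH_eq hA hs (hA.eigenProj_mem μ (toH ψ))
  -- The components of ψ sum to ψ in the norm of ℋ^s, not merely in `H`: under the isometry
  -- `partsLI` this is the expansion of a square-summable family in its coordinates.
  have h1 : HasSum e ψ := by
    rw [← Topology.IsInducing.hasSum_iff (g := partsLI (A := A) (s := s))
      partsLI.isometry.isUniformInducing.isInducing]
    convert lp.hasSum_single (p := 2) (by norm_num) (partsLI ψ) with μ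
    refine lp.ext (funext fun ν => ?_)
    simp only [Function.comp, partsLI_apply, parts_apply, he]
    by_cases hν : ν = μ
    · subst hν
      rw [lp.single_apply_self, OrthogonalEigenspaces.eigenProj_eigenProj]
    · rw [lp.single_apply_ne _ _ _ hν, hA.eigenProj_eq_zero hν (hA.eigenProj_mem μ _), smul_zero]
  refine (h1.mapL p).unique ?_
  convert h1.mapL q using 2 with μ
  exact h μ _ (by rw [he]; exact hA.eigenProj_mem μ _)

/-- Every element of `ℋ^{-s}` is represented by an element of the Hilbert sum. -/
theorem exists_inner_parts_eq (p : HsNeg A s) :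
    ∃ F : lp (fun _ : ℝ => H) 2, ∀ ψ, p ψ = inner ℝ F (partsLI ψ) := by
  -- Riesz is applied in the complete Hilbert sum: `p` is moved to the range of `partsLI` and
  -- extended by Hahn–Banach, so completeness of ℋ^s plays no role.
  let e := (partsLI (A := A) (s := s)).equivRange.toContinuousLinearEquiv
  obtain ⟨g, hg, -⟩ := exists_extension_norm_eq (𝕜 := ℝ) _
    (p ∘L e.symm.toContinuousLinearMap)
  refine ⟨(InnerProductSpace.toDual ℝ _).symm g, fun ψ => ?_⟩
  rw [InnerProductSpace.toDual_symm_apply]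
  have h := hg (e ψ)
  simp only [ContinuousLinearMap.comp_apply] at h
  have h2 : e.symm.toContinuousLinearMap (e ψ) = ψ := e.symm_apply_apply ψ
  rw [h2] at h
  exact h.symm

/-- The functional on `ℋ^s` represented by an element of the Hilbert sum. -/
def functional : lp (fun _ : ℝ => H) 2 →L[ℝ] HsNeg A s :=
  ((ContinuousLinearMap.compL ℝ (Hs A s) (lp (fun _ : ℝ => H) 2) ℝ).flip
    (partsLI (A := A) (s := s)).toContinuousLinearMap) ∘L innerSL ℝ

theorem functional_apply (F : lp (fun _ : ℝ => H) 2) (ψ : Hs A s) :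
    functional F ψ = inner ℝ F (partsLI ψ) := rfl

end Hs

/-! ### Weak derivatives on an interval -/

section WeakDerivative

variable {T : ℝ}

theorem IsTest.deriv {η : ℝ → ℝ} (h : IsTest T η) : IsTest T (deriv η) :=
  ⟨(contDiff_infty_iff_deriv.1 h.1).2, h.2.1.deriv,
    (closure_minimal support_deriv_subset (isClosed_tsupport _)).trans h.2.2⟩

theorem IsTest.integrableOn_mul {η Y : ℝ → ℝ} (h : IsTest T η) (hY : ContinuousOn Y (Icc 0 T)) :
    IntegrableOn (fun t => η t * Y t) (Ioo 0 T) :=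
  ((h.1.continuous.continuousOn.mul hY).integrableOn_Icc).mono_set Ioo_subset_Icc_self

theorem IsTest.setIntegral_mul {η : ℝ → ℝ} (h : IsTest T η) (Y : ℝ → ℝ) :
    ∫ t in Ioo 0 T, η t * Y t = ∫ t, η t * Y t :=
  setIntegral_eq_integral_of_forall_compl_eq_zero fun t ht => by
    rw [image_eq_zero_of_notMem_tsupport fun h' => ht (h.2.2 h'), zero_mul]

theorem IsTest.setIntegral_deriv_mul {η P q : ℝ → ℝ} (hη : IsTest T η)
    (hP : ∀ t, HasDerivAt P (q t) t) (hq : Continuous q) :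
    ∫ t in Ioo 0 T, _root_.deriv η t * P t = -∫ t in Ioo 0 T, η t * q t := by
  have hPc : Continuous P := continuous_iff_continuousAt.2 fun t => (hP t).continuousAt
  have hdη : ∀ t, HasDerivAt η (_root_.deriv η t) t := fun t =>
    (hη.1.differentiable (by simp) t).hasDerivAt
  rw [hη.setIntegral_mul, hη.deriv.setIntegral_mul]
  have h := integral_mul_deriv_eq_deriv_mul_of_integrable (u := η) (v := P)
    (fun t _ => hdη t) (fun t _ => hP t)
    ((hη.1.continuous.mul hq).integrable_of_hasCompactSupport hη.2.1.mul_right)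
    ((hη.deriv.1.continuous.mul hPc).integrable_of_hasCompactSupport hη.deriv.2.1.mul_right)
    ((hη.1.continuous.mul hPc).integrable_of_hasCompactSupport hη.2.1.mul_right)
  rw [h, neg_neg]

/-- The fundamental lemma of the calculus of variations; continuity then carries the almost
everywhere equality to the endpoints, where traces are read off. -/
theorem eqOn_of_forall_test (hT : 0 < T) {Y Z : ℝ → ℝ} (hY : ContinuousOn Y (Icc 0 T))
    (hZ : ContinuousOn Z (Icc 0 T))
    (h : ∀ η, IsTest T η → ∫ t in Ioo 0 T, η t * Y t = ∫ t in Ioo 0 T, η t * Z t) :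
    EqOn Y Z (Icc 0 T) := by
  have h1 : ∀ᵐ t, t ∈ Ioo 0 T → Y t - Z t = 0 := by
    refine isOpen_Ioo.ae_eq_zero_of_integral_contDiff_smul_eq_zero
      (((hY.sub hZ).mono Ioo_subset_Icc_self).locallyIntegrableOn measurableSet_Ioo)
      fun g hg hgc hgs => ?_
    have hη : IsTest T g := ⟨hg, hgc, hgs⟩
    simp only [smul_eq_mul]
    rw [← hη.setIntegral_mul (fun t => Y t - Z t)]
    simp only [mul_sub]
    rw [integral_sub (hη.integrableOn_mul hY) (hη.integrableOn_mul hZ), h g hη, sub_self]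
  refine Measure.eqOn_Icc_of_ae_eq volume hT.ne ?_ hY hZ
  rw [Measure.restrict_congr_set Ioo_ae_eq_Icc.symm]
  exact (ae_restrict_iff' measurableSet_Ioo).2 (h1.mono fun t ht hm => sub_eq_zero.1 (ht hm))

theorem eqOn_of_ae_eq (hT : 0 < T) {E : Type*} [TopologicalSpace E] [T2Space E] {Y Z : ℝ → E}
    (hY : ContinuousOn Y (Icc 0 T)) (hZ : ContinuousOn Z (Icc 0 T))
    (h : ∀ᵐ t ∂(volume.restrict (Ioo 0 T)), Y t = Z t) : EqOn Y Z (Icc 0 T) := by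
  refine Measure.eqOn_Icc_of_ae_eq volume hT.ne ?_ hY hZ
  rwa [Measure.restrict_congr_set Ioo_ae_eq_Icc.symm]

theorem exists_test_integral_eq_one (hT : 0 < T) : ∃ θ, IsTest T θ ∧ ∫ t, θ t = 1 := by
  let b : ContDiffBump (T / 2) := ⟨T / 8, T / 4, by linarith, by linarith⟩
  refine ⟨b.normed volume, ⟨b.contDiff_normed, b.hasCompactSupport_normed, ?_⟩, b.integral_normed⟩
  rw [b.tsupport_normed_eq, Real.closedBall_eq_Icc]
  rintro t ⟨h1, h2⟩
  change T / 2 - T / 4 ≤ t at h1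
  change t ≤ T / 2 + T / 4 at h2
  constructor <;> linarith

/-- The primitive from 0 vanishes to the left of the support, where nothing has been integrated, and
to its right, where the whole integral, zero, has been. -/
theorem IsTest.exists_deriv_eq {θ : ℝ → ℝ} (h : IsTest T θ) (hθ : ∫ t, θ t = 0) :
    ∃ η, IsTest T η ∧ _root_.deriv η = θ := by
  rcases (tsupport θ).eq_empty_or_nonempty with h0 | hne
  · refine ⟨0, ⟨contDiff_const, HasCompactSupport.zero, by simp⟩, ?_⟩
    rw [tsupport_eq_empty_iff.1 h0]
    simp
  have hK : IsCompact (tsupport θ) := h.2.1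
  set a := sInf (tsupport θ) with ha
  set b := sSup (tsupport θ) with hb
  have haT := h.2.2 (hK.sInf_mem hne)
  have hbT := h.2.2 (hK.sSup_mem hne)
  have hsupp : Function.support θ ⊆ Icc a b := fun t ht =>
    ⟨csInf_le hK.bddBelow (subset_tsupport _ ht), le_csSup hK.bddAbove (subset_tsupport _ ht)⟩
  have hderiv : ∀ t, HasDerivAt (fun t => ∫ r in (0 : ℝ)..t, θ r) (θ t) t := fun t =>
    intervalIntegral.integral_hasDerivAt_right (h.1.continuous.intervalIntegrable _ _)
      h.1.continuous.stronglyMeasurable.stronglyMeasurableAtFilter h.1.continuous.continuousAt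
  have hd : _root_.deriv (fun t => ∫ r in (0 : ℝ)..t, θ r) = θ := funext fun t => (hderiv t).deriv
  have hs : Function.support (fun t => ∫ r in (0 : ℝ)..t, θ r) ⊆ Icc a b := by
    intro t ht
    by_contra hn
    refine ht ?_
    by_cases hta : a ≤ t
    · have htb : b < t := not_le.1 fun h' => hn ⟨hta, h'⟩
      change ∫ r in (0 : ℝ)..t, θ r = 0
      rw [intervalIntegral.integral_eq_integral_of_support_subset
        fun r hr => ⟨haT.1.trans_le (hsupp hr).1, (hsupp hr).2.trans htb.le⟩, hθ]
    · refine intervalIntegral.integral_zero_ae (.of_forall fun r hr => ?_)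
      by_contra h'
      have h1 := (hsupp h').1
      rw [mem_uIoc] at hr
      rcases hr with hr | hr
      · linarith [hr.2]
      · linarith [hr.2, haT.1]
  have hts := closure_minimal hs isClosed_Icc
  refine ⟨_, ⟨contDiff_infty_iff_deriv.2 ⟨fun t => (hderiv t).differentiableAt, ?_⟩,
    isCompact_Icc.of_isClosed_subset (isClosed_tsupport _) hts,
    hts.trans fun t ht => ⟨haT.1.trans_le ht.1, ht.2.trans_lt hbT.2⟩⟩, hd⟩
  rw [hd]
  exact h.1

/-- The du Bois-Reymond lemma. -/
theorem exists_eqOn_const_of_weakDeriv_eq_zero (hT : 0 < T) {Z : ℝ → ℝ}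
    (hZ : ContinuousOn Z (Icc 0 T))
    (h : ∀ η, IsTest T η → ∫ t in Ioo 0 T, deriv η t * Z t = 0) :
    ∃ c : ℝ, EqOn Z (fun _ => c) (Icc 0 T) := by
  obtain ⟨θ₀, h₀, hI₀⟩ := exists_test_integral_eq_one hT
  refine ⟨∫ t in Ioo 0 T, θ₀ t * Z t, eqOn_of_forall_test hT hZ continuousOn_const fun θ hθ => ?_⟩
  have hint : ∀ {η}, IsTest T η → Integrable η := fun hη =>
    hη.1.continuous.integrable_of_hasCompactSupport hη.2.1
  set I := ∫ t, θ t with hI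
  -- Subtracting a multiple of the normalized bump makes the integral zero, so the difference is the
  -- derivative of a test function and pairs to zero with `Z`.
  have h1 : IsTest T (fun t => θ t - I * θ₀ t) := by
    refine ⟨hθ.1.sub (contDiff_const.mul h₀.1), hθ.2.1.sub h₀.2.1.mul_left, ?_⟩
    refine (tsupport_sub _ _).trans (union_subset hθ.2.2 ?_)
    exact (tsupport_mul_subset_right (f := fun _ => I)).trans h₀.2.2
  obtain ⟨η, hη, hd⟩ := h1.exists_deriv_eq (by
    rw [integral_sub (hint hθ) ((hint h₀).const_mul I), integral_const_mul, hI₀, mul_one, sub_self])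
  have h2 := h η hη
  simp only [hd, sub_mul, mul_assoc] at h2
  rw [integral_sub (hθ.integrableOn_mul hZ) ((h₀.integrableOn_mul hZ).const_mul I),
    integral_const_mul] at h2
  rw [integral_mul_const, sub_eq_zero.1 h2]
  congr 1
  have := hθ.setIntegral_mul fun _ => 1
  simp only [mul_one] at this
  rw [this]

/-- `Y` and a primitive of `p` differ by a function with zero weak derivative, hence by a constant.
-/
theorem hasDerivAt_of_weakDeriv (hT : 0 < T) {Y p : ℝ → ℝ}
    (hY : ContinuousOn Y (Icc 0 T)) (hp : ContinuousOn p (Icc 0 T))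
    (h : ∀ η, IsTest T η → ∫ t in Ioo 0 T, deriv η t * Y t = -∫ t in Ioo 0 T, η t * p t)
    {t : ℝ} (ht : t ∈ Ioo 0 T) : HasDerivAt Y (p t) t := by
  -- Extending `p` by constants beyond the endpoints makes the primitive differentiable on all of ℝ.
  set q : ℝ → ℝ := IccExtend hT.le (domRestrict (Icc 0 T) p) with hq
  have hqc : Continuous q := (continuousOn_iff_continuous_domRestrict.1 hp).Icc_extend'
  have hqp : ∀ r ∈ Icc 0 T, q r = p r := fun r hr => by
    rw [hq, IccExtend_of_mem _ _ hr]; rfl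
  have hP : ∀ t, HasDerivAt (fun t => ∫ r in (0 : ℝ)..t, q r) (q t) t := fun t =>
    intervalIntegral.integral_hasDerivAt_right (hqc.intervalIntegrable _ _)
      hqc.stronglyMeasurable.stronglyMeasurableAtFilter hqc.continuousAt
  set P : ℝ → ℝ := fun t => ∫ r in (0 : ℝ)..t, q r with hPdef
  have hPc : Continuous P := continuous_iff_continuousAt.2 fun t => (hP t).continuousAt
  obtain ⟨c, hc⟩ := exists_eqOn_const_of_weakDeriv_eq_zero hT (hY.sub hPc.continuousOn)
    fun η hη => by
      have h1 : ∫ t in Ioo 0 T, deriv η t * P t = -∫ t in Ioo 0 T, η t * p t := by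
        have h2 : ∫ t in Ioo 0 T, η t * p t = ∫ t in Ioo 0 T, η t * q t :=
          setIntegral_congr_fun measurableSet_Ioo fun r hr => by
            simp only [hqp r (Ioo_subset_Icc_self hr)]
        rw [h2, hη.setIntegral_deriv_mul hP hqc]
      simp only [Pi.sub_apply, mul_sub]
      rw [integral_sub (hη.deriv.integrableOn_mul hY)
        (hη.deriv.integrableOn_mul hPc.continuousOn), h1, h η hη, sub_self]
  have h4 : Y =ᶠ[𝓝 t] fun r => P r + c := by
    filter_upwards [isOpen_Ioo.mem_nhds ht] with r hr
    have := hc (Ioo_subset_Icc_self hr)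
    simp only [Pi.sub_apply] at this
    linarith
  rw [← hqp t (Ioo_subset_Icc_self ht)]
  exact ((hP t).add_const c).congr_of_eventuallyEq h4

/-- The conserved quantities of the equation `Y'' = μ² Y`, in weak form. -/
theorem cauchy_data_of_weak_ode (hT : 0 < T) {Y p : ℝ → ℝ} (μ : ℝ)
    (hY : ContinuousOn Y (Icc 0 T)) (hp : ContinuousOn p (Icc 0 T))
    (h1 : ∀ η, IsTest T η → ∫ t in Ioo 0 T, deriv η t * Y t = -∫ t in Ioo 0 T, η t * p t)
    (h2 : ∀ η, IsTest T η →
      ∫ t in Ioo 0 T, iteratedDeriv 2 η t * Y t = ∫ t in Ioo 0 T, η t * (μ ^ 2 * Y t)) :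
    p T * Real.cosh (μ * T) - μ * Y T * Real.sinh (μ * T) = p 0 ∧
      μ * Y T * Real.cosh (μ * T) - p T * Real.sinh (μ * T) = μ * Y 0 := by
  have hdY : ∀ t ∈ Ioo 0 T, HasDerivAt Y (p t) t := fun t ht => hasDerivAt_of_weakDeriv hT hY hp h1 ht
  have hdp : ∀ t ∈ Ioo 0 T, HasDerivAt p (μ ^ 2 * Y t) t := fun t ht =>
    hasDerivAt_of_weakDeriv (p := fun t => μ ^ 2 * Y t) hT hp (continuousOn_const.mul hY) (fun η hη => by
      rw [← h2 η hη, iteratedDeriv_succ, iteratedDeriv_one, h1 _ hη.deriv, neg_neg]) ht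
  have hm : ∀ t : ℝ, HasDerivAt (fun t => μ * t) μ t := fun t => by
    simpa using (hasDerivAt_id t).const_mul μ
  have hch : ∀ t : ℝ, HasDerivAt (fun t => Real.cosh (μ * t)) (Real.sinh (μ * t) * μ) t :=
    fun t => (hm t).cosh
  have hsh : ∀ t : ℝ, HasDerivAt (fun t => Real.sinh (μ * t)) (Real.cosh (μ * t) * μ) t :=
    fun t => (hm t).sinh
  have hcc : ContinuousOn (fun t => Real.cosh (μ * t)) (Icc 0 T) := by fun_prop
  have hsc : ContinuousOn (fun t => Real.sinh (μ * t)) (Icc 0 T) := by fun_prop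
  have key : ∀ Q : ℝ → ℝ, ContinuousOn Q (Icc 0 T) → (∀ t ∈ Ioo 0 T, HasDerivAt Q 0 t) →
      Q T = Q 0 := fun Q hQ hQ' => by
    obtain ⟨c, -, hc⟩ := exists_hasDerivAt_eq_slope Q (fun _ => 0) hT hQ hQ'
    have : (Q T - Q 0) / (T - 0) = 0 := hc.symm
    rw [div_eq_zero_iff] at this
    rcases this with h | h <;> linarith
  -- These two quantities undo the hyperbolic rotation of (p, μY) through μt, so their derivatives
  -- vanish.
  constructor
  · have := key (fun t => p t * Real.cosh (μ * t) - μ * Y t * Real.sinh (μ * t))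
      ((hp.mul hcc).sub ((continuousOn_const.mul hY).mul hsc)) fun t ht => by
        refine (((hdp t ht).mul (hch t)).sub (((hdY t ht).const_mul μ).mul (hsh t))).congr_deriv ?_
        ring
    simpa using this
  · have := key (fun t => μ * Y t * Real.cosh (μ * t) - p t * Real.sinh (μ * t))
      (((continuousOn_const.mul hY).mul hcc).sub (hp.mul hsc)) fun t ht => by
        refine ((((hdY t ht).const_mul μ).mul (hch t)).sub ((hdp t ht).mul (hsh t))).congr_deriv ?_
        ring
    simpa using this

end WeakDerivative

/-! ### Paths in a Hilbert sum -/

section HilbertSumPaths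

variable {H : Type*} [NormedAddCommGroup H] {ι : Type*}

theorem lp_norm_sq (x : lp (fun _ : ι => H) 2) : ‖x‖ ^ 2 = ∑' i, ‖x i‖ ^ 2 := by
  have h := lp.norm_rpow_eq_tsum (p := 2) (by norm_num) x
  simpa only [ENNReal.toReal_ofNat, Real.rpow_ofNat] using h

/-- Dominated convergence for the series of ‖G t - G t₀‖², whose terms are at most (2b)². -/
theorem continuousOn_lp {S : Set ℝ} {G : ℝ → lp (fun _ : ι => H) 2} {b : ι → ℝ}
    (hb : Summable fun i => b i ^ 2) (hG : ∀ i, ContinuousOn (fun t => G t i) S)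
    (hbd : ∀ t ∈ S, ∀ i, ‖G t i‖ ≤ b i) : ContinuousOn G S := by
  intro t₀ ht₀
  rw [ContinuousWithinAt, tendsto_iff_norm_sub_tendsto_zero]
  have h1 : Tendsto (fun t => ‖G t - G t₀‖ ^ 2) (𝓝[S] t₀) (𝓝 0) := by
    simp only [lp_norm_sq]
    rw [← tsum_zero (α := ℝ) (β := ι)]
    refine tendsto_tsum_of_dominated_convergence (bound := fun i => 4 * b i ^ 2)
      (hb.mul_left 4) (fun i => ?_) ?_
    · have h2 := tendsto_iff_norm_sub_tendsto_zero.1 (hG i t₀ ht₀)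
      simpa using h2.pow 2
    · filter_upwards [self_mem_nhdsWithin] with t ht i
      have h3 : ‖(G t - G t₀ : lp (fun _ : ι => H) 2) i‖ ≤ 2 * b i := by
        rw [lp.coeFn_sub, Pi.sub_apply]
        have := norm_sub_le (G t i) (G t₀ i)
        linarith [hbd t ht i, hbd t₀ ht₀ i]
      rw [norm_pow, norm_norm]
      calc _ ≤ (2 * b i) ^ 2 := by gcongr
        _ = _ := by ring
  simpa using h1.sqrt

/-- Termwise integration of a dominated series with arbitrary index type. -/
theorem hasSum_setIntegral {T : ℝ} {F : ι → ℝ → ℝ} {f : ℝ → ℝ} {B : ι → ℝ} (hB : Summable B)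
    (hF : ∀ i, Continuous (F i)) (hbd : ∀ t ∈ Ioo 0 T, ∀ i, |F i t| ≤ B i)
    (hf : ∀ᵐ t ∂(volume.restrict (Ioo 0 T)), HasSum (fun i => F i t) (f t)) :
    HasSum (fun i => ∫ t in Ioo 0 T, F i t) (∫ t in Ioo 0 T, f t) := by
  -- Termwise integration needs a countable index set; outside the countable support of `B` all
  -- terms vanish on (0, T).
  set N := Function.support B with hN
  have hNc : N.Countable := hB.countable_support
  have h0 : ∀ i ∉ N, ∀ t ∈ Ioo 0 T, F i t = 0 := fun i hi t ht => by
    have := hbd t ht i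
    rw [Function.notMem_support.1 hi] at this
    exact abs_nonpos_iff.1 this
  have : Countable N := hNc
  have hae : ∀ᵐ t ∂(volume.restrict (Ioo 0 T)), t ∈ Ioo 0 T := ae_restrict_mem measurableSet_Ioo
  have hs : Function.support (fun i => ∫ t in Ioo 0 T, F i t) ⊆ N := fun i hi => by
    by_contra h
    exact hi (setIntegral_eq_zero_of_forall_eq_zero (h0 i h))
  rw [← hasSum_subtype_iff_of_support_subset hs]
  refine hasSum_integral_of_dominated_convergence (fun i _ => B i)
    (fun i => (hF i).aestronglyMeasurable) (fun i => ?_) (.of_forall fun _ => hB.subtype _)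
    (integrable_const _) ?_
  · filter_upwards [hae] with t ht using hbd t ht i
  · filter_upwards [hae, hf] with t ht h
    refine (hasSum_subtype_iff_of_support_subset (f := fun i => F i t) fun i hi => ?_).2 h
    by_contra h'
    exact hi (h0 i h' t ht)

variable {ν : Measure ℝ} {a : ℝ → ι → H} {N : Set ι} {B : ι → ℝ}

/-- Tonelli. Only time integrals of the components are bounded here, because the ℋ¹ norm of the
solution need not be finite at the endpoints. -/
theorem lintegral_tsum_lt_top (hN : N.Countable) (hB : Summable B)
    (ha : ∀ i, Continuous fun t => a t i)
    (hint : ∀ i, ∫⁻ t, ENNReal.ofReal (‖a t i‖ ^ 2) ∂ν ≤ ENNReal.ofReal (B i)) :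
    ∫⁻ t, ∑' i : N, ENNReal.ofReal (‖a t i‖ ^ 2) ∂ν < ⊤ := by
  have : Countable N := hN
  have hm : ∀ i : N, AEMeasurable (fun t => ENNReal.ofReal (‖a t i‖ ^ 2)) ν := fun i =>
    (((ha i).norm.pow 2).measurable.ennreal_ofReal).aemeasurable
  rw [lintegral_tsum hm]
  refine (ENNReal.tsum_le_tsum fun i : N => hint i).trans_lt ?_
  exact (hB.subtype N).tsum_ofReal_lt_top

theorem ae_summable_norm_sq (hN : N.Countable) (hB : Summable B)
    (ha : ∀ i, Continuous fun t => a t i) (h0 : ∀ t, ∀ i ∉ N, a t i = 0)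
    (hint : ∀ i, ∫⁻ t, ENNReal.ofReal (‖a t i‖ ^ 2) ∂ν ≤ ENNReal.ofReal (B i)) :
    ∀ᵐ t ∂ν, Summable fun i => ‖a t i‖ ^ 2 := by
  have : Countable N := hN
  have hm : AEMeasurable (fun t => ∑' i : N, ENNReal.ofReal (‖a t i‖ ^ 2)) ν :=
    AEMeasurable.tsum fun i =>
      (((ha i).norm.pow 2).measurable.ennreal_ofReal).aemeasurable
  filter_upwards [ae_lt_top' hm (lintegral_tsum_lt_top hN hB ha hint).ne] with t ht
  rw [← Subtype.val_injective.summable_iff (f := fun i => ‖a t i‖ ^ 2) (g := ((↑) : N → ι))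
    fun i hi => by rw [h0 t i (by simpa using hi)]; simp]
  have := ENNReal.summable_toReal ht.ne
  simpa [Function.comp_def] using this

theorem memLp_two_of_components {G : ℝ → lp (fun _ : ι => H) 2} (hN : N.Countable)
    (hB : Summable B) (ha : ∀ i, Continuous fun t => a t i) (h0 : ∀ t, ∀ i ∉ N, a t i = 0)
    (hint : ∀ i, ∫⁻ t, ENNReal.ofReal (‖a t i‖ ^ 2) ∂ν ≤ ENNReal.ofReal (B i))
    (hG : ∀ᵐ t ∂ν, ∀ i, G t i = a t i) : MemLp G 2 ν := by
  classical
  have : Countable N := hN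
  refine ⟨?_, ?_⟩
  · refine aestronglyMeasurable_of_tendsto_ae (u := (atTop : Filter (Finset N)))
      (f := fun s t => ∑ i ∈ s, lp.single (E := fun _ : ι => H) 2 (i : ι) (a t i))
      (fun s => ?_) ?_
    · refine Continuous.aestronglyMeasurable (continuous_finsetSum _ fun i _ => ?_)
      exact (lp.isometry_single (E := fun _ : ι => H) (p := 2) (i : ι)).continuous.comp (ha i)
    · filter_upwards [hG] with t ht
      have h1 := lp.hasSum_single (E := fun _ : ι => H) (p := 2) (by norm_num) (G t)
      simp only [ht] at h1
      refine (hasSum_subtype_iff_of_support_subset (s := N) fun i hi => ?_).2 h1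
      by_contra h
      simp [h0 t i h] at hi
  · rw [eLpNorm_lt_top_iff_lintegral_rpow_enorm_lt_top (by norm_num) (by norm_num)]
    refine lt_of_eq_of_lt (lintegral_congr_ae ?_) (lintegral_tsum_lt_top hN hB ha hint)
    filter_upwards [hG] with t ht
    have hs : Function.support (fun i => ‖a t i‖ ^ 2) ⊆ N := fun i hi => by
      by_contra h
      simp [h0 t i h] at hi
    have h2 : ‖G t‖ ^ 2 = ∑' i : N, ‖a t i‖ ^ 2 := by
      rw [lp_norm_sq, ← tsum_subtype_eq_of_support_subset (s := N) (by simpa only [ht] using hs)]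
      simp only [ht]
    have h3 : Summable fun i => ‖a t i‖ ^ 2 := by
      have := (memℓp_gen_iff (p := 2) (by norm_num)).1 (G t).2
      simpa [ht] using this
    have h4 : Summable fun i : N => ‖a t i‖ ^ 2 := h3.subtype N
    rw [← ENNReal.ofReal_tsum_of_nonneg (fun _ => by positivity) h4, ← h2]
    simp only [ENNReal.toReal_ofNat, ENNReal.rpow_ofNat]
    rw [← ofReal_norm, ← ENNReal.ofReal_pow (norm_nonneg _)]

end HilbertSumPaths

/-! ### The elementary solutions of the mixed problem -/

section Coefficients

/-- The solution of `y'' = μ² y`, `y(0) = 0`, `y'(0) = 1`. -/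
def sinhKernel (μ t : ℝ) : ℝ := ∫ r in (0 : ℝ)..t, Real.cosh (μ * r)

/-- The solution of `y'' = μ² y`, `y(0) = 1`, `y'(T) = 0`. -/
def dirichletCoeff (T μ t : ℝ) : ℝ := Real.cosh (μ * (T - t)) / Real.cosh (μ * T)

/-- The derivative of `dirichletCoeff`. -/
def dirichletCoeff' (T μ t : ℝ) : ℝ := -(μ * Real.sinh (μ * (T - t))) / Real.cosh (μ * T)

/-- The solution of `y'' = μ² y`, `y(0) = 0`, `y'(T) = 1`. -/
def neumannCoeff (T μ t : ℝ) : ℝ := sinhKernel μ t / Real.cosh (μ * T)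

/-- The derivative of `neumannCoeff`. -/
def neumannCoeff' (T μ t : ℝ) : ℝ := Real.cosh (μ * t) / Real.cosh (μ * T)

theorem hasDerivAt_sinhKernel (μ t : ℝ) : HasDerivAt (sinhKernel μ) (Real.cosh (μ * t)) t := by
  have hc : Continuous fun r => Real.cosh (μ * r) := by fun_prop
  exact intervalIntegral.integral_hasDerivAt_right (hc.intervalIntegrable _ _)
    hc.stronglyMeasurable.stronglyMeasurableAtFilter hc.continuousAt

/-- For μ ≠ 0 the kernel is thus sinh(μt)/μ; its integral form covers μ = 0 without a case
distinction. -/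
theorem mul_sinhKernel (μ t : ℝ) : μ * sinhKernel μ t = Real.sinh (μ * t) := by
  have h : ∀ r ∈ uIcc 0 t, HasDerivAt (fun r => Real.sinh (μ * r)) (μ * Real.cosh (μ * r)) r :=
    fun r _ => by
      have := ((hasDerivAt_id r).const_mul μ).sinh
      simpa [mul_comm] using this
  have h2 := intervalIntegral.integral_eq_sub_of_hasDerivAt h
    (Continuous.intervalIntegrable (by fun_prop) _ _)
  rw [intervalIntegral.integral_const_mul] at h2
  simpa [sinhKernel] using h2

theorem cosh_mul_le {μ r t : ℝ} (hr : 0 ≤ r) (hrt : r ≤ t) :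
    Real.cosh (μ * r) ≤ Real.cosh (μ * t) := by
  rw [Real.cosh_le_cosh, abs_mul, abs_mul, abs_of_nonneg hr, abs_of_nonneg (hr.trans hrt)]
  gcongr

theorem abs_sinh_le_cosh (x : ℝ) : |Real.sinh x| ≤ Real.cosh x :=
  abs_le_of_sq_le_sq (by nlinarith [Real.cosh_sq x]) (Real.cosh_pos x).le

theorem abs_sinhKernel_le {μ t : ℝ} (ht : 0 ≤ t) :
    |sinhKernel μ t| ≤ t * Real.cosh (μ * t) := by
  have h := intervalIntegral.norm_integral_le_of_norm_le_const (a := 0) (b := t)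
    (f := fun r => Real.cosh (μ * r)) (C := Real.cosh (μ * t)) fun r hr => by
      rw [uIoc_of_le ht] at hr
      rw [Real.norm_of_nonneg (Real.cosh_pos _).le]
      exact cosh_mul_le hr.1.le hr.2
  rw [sub_zero, abs_of_nonneg ht, mul_comm] at h
  exact h

theorem sinhKernel_nonneg {μ t : ℝ} (ht : 0 ≤ t) : 0 ≤ sinhKernel μ t :=
  intervalIntegral.integral_nonneg ht fun _ _ => (Real.cosh_pos _).le

theorem hasDerivAt_dirichletCoeff (T μ t : ℝ) :
    HasDerivAt (dirichletCoeff T μ) (dirichletCoeff' T μ t) t := by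
  have := ((((hasDerivAt_id t).const_sub T).const_mul μ).cosh).div_const (Real.cosh (μ * T))
  refine this.congr_deriv ?_
  simp only [dirichletCoeff', id]
  ring

theorem hasDerivAt_dirichletCoeff' (T μ t : ℝ) :
    HasDerivAt (dirichletCoeff' T μ) (μ ^ 2 * dirichletCoeff T μ t) t := by
  have := (((((hasDerivAt_id t).const_sub T).const_mul μ).sinh.const_mul μ).neg).div_const
    (Real.cosh (μ * T))
  refine this.congr_deriv ?_
  simp only [dirichletCoeff, id]
  ring

theorem hasDerivAt_neumannCoeff (T μ t : ℝ) :
    HasDerivAt (neumannCoeff T μ) (neumannCoeff' T μ t) t :=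
  (hasDerivAt_sinhKernel μ t).div_const _

theorem hasDerivAt_neumannCoeff' (T μ t : ℝ) :
    HasDerivAt (neumannCoeff' T μ) (μ ^ 2 * neumannCoeff T μ t) t := by
  have := (((hasDerivAt_id t).const_mul μ).cosh).div_const (Real.cosh (μ * T))
  refine this.congr_deriv ?_
  simp only [neumannCoeff, id]
  rw [← mul_sinhKernel]
  ring

variable {T t : ℝ} (μ : ℝ)

theorem dirichletCoeff_nonneg : 0 ≤ dirichletCoeff T μ t :=
  div_nonneg (Real.cosh_pos _).le (Real.cosh_pos _).le

theorem dirichletCoeff_le_one (ht : t ∈ Icc 0 T) : dirichletCoeff T μ t ≤ 1 :=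
  (div_le_one (Real.cosh_pos _)).2 (cosh_mul_le (by linarith [ht.2]) (by linarith [ht.1]))

theorem neumannCoeff'_nonneg : 0 ≤ neumannCoeff' T μ t :=
  div_nonneg (Real.cosh_pos _).le (Real.cosh_pos _).le

theorem neumannCoeff'_le_one (ht : t ∈ Icc 0 T) : neumannCoeff' T μ t ≤ 1 :=
  (div_le_one (Real.cosh_pos _)).2 (cosh_mul_le ht.1 ht.2)

theorem abs_dirichletCoeff'_le (ht : t ∈ Icc 0 T) : |dirichletCoeff' T μ t| ≤ √(1 + μ ^ 2) := by
  have h1 : |μ| ≤ √(1 + μ ^ 2) := Real.abs_le_sqrt (by linarith)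
  rw [dirichletCoeff', abs_div, abs_neg, abs_mul, abs_of_pos (Real.cosh_pos (μ * T)),
    div_le_iff₀ (Real.cosh_pos _)]
  gcongr
  exact (abs_sinh_le_cosh _).trans (cosh_mul_le (by linarith [ht.2]) (by linarith [ht.1]))

theorem neumannCoeff_nonneg (ht : t ∈ Icc 0 T) : 0 ≤ neumannCoeff T μ t :=
  div_nonneg (sinhKernel_nonneg ht.1) (Real.cosh_pos _).le

theorem neumannCoeff_le_mul (ht : t ∈ Icc 0 T) :
    neumannCoeff T μ t ≤ T * neumannCoeff' T μ t := by
  rw [neumannCoeff, neumannCoeff', ← mul_div_assoc]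
  have h := (le_abs_self _).trans (abs_sinhKernel_le (μ := μ) ht.1)
  have := Real.cosh_pos (μ * T)
  have := Real.cosh_pos (μ * t)
  gcongr
  exact h.trans (by gcongr; exact ht.2)

theorem abs_mul_neumannCoeff_le : |μ * neumannCoeff T μ t| ≤ neumannCoeff' T μ t := by
  rw [neumannCoeff, neumannCoeff', ← mul_div_assoc, mul_sinhKernel, abs_div,
    abs_of_pos (Real.cosh_pos (μ * T))]
  have := Real.cosh_pos (μ * T)
  gcongr
  exact abs_sinh_le_cosh _

/-- The Neumann datum gains one full power of √(1 + μ²) ≤ 1 + |μ|: the summand 1 contributes at most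
`T` (`neumannCoeff_le_mul`), and |μ| at most 1 (`abs_mul_neumannCoeff_le`). -/
theorem sqrt_mul_neumannCoeff_le (ht : t ∈ Icc 0 T) :
    √(1 + μ ^ 2) * neumannCoeff T μ t ≤ 1 + T := by
  have h1 := neumannCoeff'_le_one μ ht
  have h2 := (abs_mul_neumannCoeff_le (T := T) (t := t) μ).trans h1
  have h3 := (neumannCoeff_le_mul μ ht).trans
    (mul_le_of_le_one_right (ht.1.trans ht.2) h1)
  have h4 : √(1 + μ ^ 2) ≤ 1 + |μ| :=
    Real.sqrt_le_iff.2 ⟨by positivity, by nlinarith [sq_abs μ, abs_nonneg μ]⟩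
  rw [abs_mul, abs_of_nonneg (neumannCoeff_nonneg μ ht)] at h2
  nlinarith [mul_le_mul_of_nonneg_right h4 (neumannCoeff_nonneg μ ht)]

/-- The square of `neumannCoeff'` is at most itself, as it lies in [0, 1]; the resulting bound is
linear in a function with explicit integral. -/
theorem sq_mul_neumannCoeff_sq_le (ht : t ∈ Icc 0 T) :
    (1 + μ ^ 2) * neumannCoeff T μ t ^ 2 ≤ (1 + T ^ 2) * neumannCoeff' T μ t := by
  have h1 := neumannCoeff'_le_one μ ht
  have h0 : neumannCoeff' T μ t ^ 2 ≤ neumannCoeff' T μ t := by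
    nlinarith [neumannCoeff'_nonneg (T := T) (t := t) μ]
  have h2 : (μ * neumannCoeff T μ t) ^ 2 ≤ neumannCoeff' T μ t ^ 2 :=
    sq_le_sq.2 ((abs_mul_neumannCoeff_le μ).trans (le_abs_self _))
  have h3 : neumannCoeff T μ t ^ 2 ≤ (T * neumannCoeff' T μ t) ^ 2 :=
    pow_le_pow_left₀ (neumannCoeff_nonneg μ ht) (neumannCoeff_le_mul μ ht) 2
  nlinarith [mul_le_mul_of_nonneg_left h0 (sq_nonneg T)]

theorem continuous_dirichletCoeff (T μ : ℝ) : Continuous (dirichletCoeff T μ) :=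
  continuous_iff_continuousAt.2 fun t => (hasDerivAt_dirichletCoeff T μ t).continuousAt

theorem continuous_neumannCoeff (T μ : ℝ) : Continuous (neumannCoeff T μ) :=
  continuous_iff_continuousAt.2 fun t => (hasDerivAt_neumannCoeff T μ t).continuousAt

theorem continuous_dirichletCoeff' (T μ : ℝ) : Continuous (dirichletCoeff' T μ) :=
  continuous_iff_continuousAt.2 fun t => (hasDerivAt_dirichletCoeff' T μ t).continuousAt

theorem continuous_neumannCoeff' (T μ : ℝ) : Continuous (neumannCoeff' T μ) :=
  continuous_iff_continuousAt.2 fun t => (hasDerivAt_neumannCoeff' T μ t).continuousAt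

/-- This integral and that of `dirichletCoeff` both equal tanh(μT)/μ (`T` at μ = 0), of order 1/√(1
+ μ²): this is the half derivative gained by integrating in time. -/
theorem integral_neumannCoeff' (hT : 0 ≤ T) :
    ∫ t in Ioo 0 T, neumannCoeff' T μ t = neumannCoeff T μ T := by
  rw [← integral_Ioc_eq_integral_Ioo, ← intervalIntegral.integral_of_le hT]
  simp only [neumannCoeff', neumannCoeff, sinhKernel, intervalIntegral.integral_div]

theorem integral_dirichletCoeff (hT : 0 ≤ T) :
    ∫ t in Ioo 0 T, dirichletCoeff T μ t = neumannCoeff T μ T := by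
  rw [← integral_Ioc_eq_integral_Ioo, ← intervalIntegral.integral_of_le hT]
  simp only [dirichletCoeff, neumannCoeff, sinhKernel, intervalIntegral.integral_div]
  rw [intervalIntegral.integral_comp_sub_left (fun r => Real.cosh (μ * r)) T]
  simp

end Coefficients

/-! ### The solution of the mixed problem -/

section MixedProblem

variable {H : Type*} [NormedAddCommGroup H]

/-- A bound for the components of the solution of the mixed problem, in all the norms used. -/
def mixedBound (T : ℝ) (f Φ : ℝ → H) (μ : ℝ) : ℝ :=
  2 * (1 + T) ^ 2 * (1 + T ^ 2) * (√(1 + μ ^ 2) * ‖f μ‖ ^ 2 + (√(1 + μ ^ 2))⁻¹ * ‖Φ μ‖ ^ 2)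

variable {T : ℝ} {f Φ : ℝ → H}

theorem mixedBound_nonneg (μ : ℝ) : 0 ≤ mixedBound T f Φ μ := by
  unfold mixedBound; positivity

theorem summable_mixedBound (hf : Summable fun μ => √(1 + μ ^ 2) * ‖f μ‖ ^ 2)
    (hΦ : Summable fun μ => (√(1 + μ ^ 2))⁻¹ * ‖Φ μ‖ ^ 2) : Summable (mixedBound T f Φ) :=
  (hf.add hΦ).mul_left _

/-- It confines the data, and with them the solution, to the countable support of the summable
majorant. -/
theorem eq_zero_of_mixedBound_eq_zero (hT : 0 < T) {μ : ℝ} (h : mixedBound T f Φ μ = 0) :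
    f μ = 0 ∧ Φ μ = 0 := by
  have hC : 2 * (1 + T) ^ 2 * (1 + T ^ 2) ≠ 0 := by positivity
  have hm : 0 < √(1 + μ ^ 2) := by positivity
  have h1 := (mul_eq_zero.1 h).resolve_left hC
  have h2 : √(1 + μ ^ 2) * ‖f μ‖ ^ 2 = 0 ∧ (√(1 + μ ^ 2))⁻¹ * ‖Φ μ‖ ^ 2 = 0 := by
    refine (add_eq_zero_iff_of_nonneg (by positivity) (by positivity)).1 h1
  simpa [hm.ne'] using h2

theorem norm_add_sq_le (x y : H) : ‖x + y‖ ^ 2 ≤ 2 * ‖x‖ ^ 2 + 2 * ‖y‖ ^ 2 := by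
  have h := norm_add_le x y
  nlinarith [sq_nonneg (‖x‖ - ‖y‖), norm_nonneg (x + y)]

variable [InnerProductSpace ℝ H]

/-- The components of the solution with `u(0) = f`, `∂_t u(T) = Φ`. -/
def mixedSol (T : ℝ) (f Φ : ℝ → H) (t μ : ℝ) : H :=
  dirichletCoeff T μ t • f μ + neumannCoeff T μ t • Φ μ

/-- The components of the time derivative of `mixedSol`. -/
def mixedSol' (T : ℝ) (f Φ : ℝ → H) (t μ : ℝ) : H :=
  dirichletCoeff' T μ t • f μ + neumannCoeff' T μ t • Φ μ

theorem sqrt_mul_norm_mixedSol_sq_le {t : ℝ} (ht : t ∈ Icc 0 T) (μ : ℝ) :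
    √(1 + μ ^ 2) * ‖mixedSol T f Φ t μ‖ ^ 2 ≤ mixedBound T f Φ μ := by
  have hT : 0 ≤ T := ht.1.trans ht.2
  set m := √(1 + μ ^ 2) with hm
  have hm0 : 0 < m := by positivity
  set α := dirichletCoeff T μ t
  set β := neumannCoeff T μ t
  have hα0 : 0 ≤ α := dirichletCoeff_nonneg μ
  have hα : α ^ 2 ≤ 1 := pow_le_one₀ hα0 (dirichletCoeff_le_one μ ht)
  have hβ : (m * β) ^ 2 ≤ (1 + T) ^ 2 := pow_le_pow_left₀
    (mul_nonneg hm0.le (neumannCoeff_nonneg μ ht)) (sqrt_mul_neumannCoeff_le μ ht) 2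
  have h1 := norm_add_sq_le (α • f μ) (β • Φ μ)
  rw [norm_smul, norm_smul, mul_pow, mul_pow, Real.norm_eq_abs, Real.norm_eq_abs, sq_abs, sq_abs]
    at h1
  calc m * ‖mixedSol T f Φ t μ‖ ^ 2 ≤ m * (2 * (α ^ 2 * ‖f μ‖ ^ 2) + 2 * (β ^ 2 * ‖Φ μ‖ ^ 2)) := by
        gcongr
        exact h1
    _ = 2 * α ^ 2 * (m * ‖f μ‖ ^ 2) + 2 * (m * β) ^ 2 * (m⁻¹ * ‖Φ μ‖ ^ 2) := by
        field_simp
    _ ≤ 2 * (1 + T) ^ 2 * (1 + T ^ 2) * (m * ‖f μ‖ ^ 2) +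
          2 * (1 + T) ^ 2 * (1 + T ^ 2) * (m⁻¹ * ‖Φ μ‖ ^ 2) := by
        gcongr ?_ * _ + ?_ * _
        · nlinarith [mul_nonneg (sq_nonneg (1 + T)) (sq_nonneg T)]
        · nlinarith [mul_nonneg (sq_nonneg (1 + T)) (sq_nonneg T)]
    _ = _ := by rw [mixedBound]; ring

theorem inv_sqrt_mul_norm_mixedSol'_sq_le {t : ℝ} (ht : t ∈ Icc 0 T) (μ : ℝ) :
    (√(1 + μ ^ 2))⁻¹ * ‖mixedSol' T f Φ t μ‖ ^ 2 ≤ mixedBound T f Φ μ := by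
  have hT : 0 ≤ T := ht.1.trans ht.2
  have hα : |dirichletCoeff' T μ t| ≤ √(1 + μ ^ 2) := abs_dirichletCoeff'_le μ ht
  set m := √(1 + μ ^ 2) with hm
  have hm0 : 0 < m := by positivity
  set α := dirichletCoeff' T μ t
  set β := neumannCoeff' T μ t
  have hα : α ^ 2 ≤ m ^ 2 := sq_le_sq.2 (hα.trans (le_abs_self _))
  have hβ : β ^ 2 ≤ 1 := pow_le_one₀ (neumannCoeff'_nonneg μ) (neumannCoeff'_le_one μ ht)
  have h1 := norm_add_sq_le (α • f μ) (β • Φ μ)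
  rw [norm_smul, norm_smul, mul_pow, mul_pow, Real.norm_eq_abs, Real.norm_eq_abs, sq_abs, sq_abs]
    at h1
  calc m⁻¹ * ‖mixedSol' T f Φ t μ‖ ^ 2
      ≤ m⁻¹ * (2 * (m ^ 2 * ‖f μ‖ ^ 2) + 2 * (1 * ‖Φ μ‖ ^ 2)) := by
        gcongr
        exact h1.trans (by gcongr)
    _ = 2 * (m * ‖f μ‖ ^ 2) + 2 * (m⁻¹ * ‖Φ μ‖ ^ 2) := by
        field_simp
    _ ≤ 2 * (1 + T) ^ 2 * (1 + T ^ 2) * (m * ‖f μ‖ ^ 2) +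
          2 * (1 + T) ^ 2 * (1 + T ^ 2) * (m⁻¹ * ‖Φ μ‖ ^ 2) := by
        have : (2 : ℝ) ≤ 2 * (1 + T) ^ 2 * (1 + T ^ 2) := by
          nlinarith [mul_nonneg (sq_nonneg (1 + T)) (sq_nonneg T)]
        gcongr
    _ = _ := by rw [mixedBound]; ring

/-- The ℋ¹ weight is 1 + μ² = m², but the weighted squares are bounded linearly by `dirichletCoeff`
and `neumannCoeff'`, whose integrals are at most (1 + T)/m. This leaves the weights m on f and m⁻¹
on Φ. -/
theorem lintegral_norm_mixedSol_sq_le (hT : 0 < T) (μ : ℝ) :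
    ∫⁻ t in Ioo 0 T, ENNReal.ofReal (‖(1 + μ ^ 2) ^ ((1 : ℝ) / 2) • mixedSol T f Φ t μ‖ ^ 2) ≤
      ENNReal.ofReal (mixedBound T f Φ μ) := by
  set C₁ := 2 * (1 + μ ^ 2) * ‖f μ‖ ^ 2 with hC₁
  set C₂ := 2 * (1 + T ^ 2) * ‖Φ μ‖ ^ 2 with hC₂
  have hcont : Continuous fun t => C₁ * dirichletCoeff T μ t + C₂ * neumannCoeff' T μ t :=
    (continuous_const.mul (continuous_dirichletCoeff T μ)).add
      (continuous_const.mul (continuous_neumannCoeff' T μ))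
  have hint : ∀ {g : ℝ → ℝ}, Continuous g → IntegrableOn g (Ioo 0 T) := fun hg =>
    hg.continuousOn.integrableOn_Icc.mono_set Ioo_subset_Icc_self
  have hnn : ∀ t, 0 ≤ C₁ * dirichletCoeff T μ t + C₂ * neumannCoeff' T μ t := fun t =>
    add_nonneg (mul_nonneg (by positivity) (dirichletCoeff_nonneg μ))
      (mul_nonneg (by positivity) (neumannCoeff'_nonneg μ))
  have h1 : ∀ t ∈ Ioo 0 T, ‖(1 + μ ^ 2) ^ ((1 : ℝ) / 2) • mixedSol T f Φ t μ‖ ^ 2 ≤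
      C₁ * dirichletCoeff T μ t + C₂ * neumannCoeff' T μ t := fun t ht => by
    have ht' := Ioo_subset_Icc_self ht
    rw [Hs.norm_rpow_smul_sq, Real.rpow_one]
    have h2 := norm_add_sq_le (dirichletCoeff T μ t • f μ) (neumannCoeff T μ t • Φ μ)
    rw [norm_smul, norm_smul, mul_pow, mul_pow, Real.norm_eq_abs, Real.norm_eq_abs, sq_abs,
      sq_abs] at h2
    have hα : dirichletCoeff T μ t ^ 2 ≤ dirichletCoeff T μ t := by
      nlinarith [dirichletCoeff_nonneg (T := T) (t := t) μ, dirichletCoeff_le_one μ ht']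
    have hβ := sq_mul_neumannCoeff_sq_le μ ht'
    calc (1 + μ ^ 2) * ‖mixedSol T f Φ t μ‖ ^ 2
        ≤ (1 + μ ^ 2) * (2 * (dirichletCoeff T μ t ^ 2 * ‖f μ‖ ^ 2) +
            2 * (neumannCoeff T μ t ^ 2 * ‖Φ μ‖ ^ 2)) := by gcongr; exact h2
      _ = C₁ * dirichletCoeff T μ t ^ 2 +
            2 * ‖Φ μ‖ ^ 2 * ((1 + μ ^ 2) * neumannCoeff T μ t ^ 2) := by rw [hC₁]; ring
      _ ≤ C₁ * dirichletCoeff T μ t + 2 * ‖Φ μ‖ ^ 2 * ((1 + T ^ 2) * neumannCoeff' T μ t) := by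
          gcongr
      _ = _ := by rw [hC₂]; ring
  refine (setLIntegral_mono (hcont.measurable.ennreal_ofReal)
    fun t ht => ENNReal.ofReal_le_ofReal (h1 t ht)).trans ?_
  rw [← ofReal_integral_eq_lintegral_ofReal (hint hcont) (.of_forall hnn)]
  refine ENNReal.ofReal_le_ofReal ?_
  rw [integral_add ((hint (continuous_dirichletCoeff T μ)).const_mul _)
    ((hint (continuous_neumannCoeff' T μ)).const_mul _), integral_const_mul, integral_const_mul,
    integral_dirichletCoeff μ hT.le, integral_neumannCoeff' μ hT.le, ← add_mul]
  set m := √(1 + μ ^ 2) with hm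
  have hm0 : 0 < m := by positivity
  have hmm : 1 + μ ^ 2 = m ^ 2 := (Real.sq_sqrt (by positivity)).symm
  have h3 : neumannCoeff T μ T ≤ (1 + T) / m := by
    rw [le_div_iff₀ hm0, mul_comm]
    exact sqrt_mul_neumannCoeff_le μ (right_mem_Icc.2 hT.le)
  calc (C₁ + C₂) * neumannCoeff T μ T ≤ (C₁ + C₂) * ((1 + T) / m) := by gcongr
    _ = 2 * (1 + T) * (m * ‖f μ‖ ^ 2) + 2 * (1 + T) * (1 + T ^ 2) * (m⁻¹ * ‖Φ μ‖ ^ 2) := by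
        rw [hC₁, hC₂, hmm]
        field_simp
    _ ≤ 2 * (1 + T) ^ 2 * (1 + T ^ 2) * (m * ‖f μ‖ ^ 2) +
          2 * (1 + T) ^ 2 * (1 + T ^ 2) * (m⁻¹ * ‖Φ μ‖ ^ 2) := by
        have h4 : 1 + T ≤ (1 + T) ^ 2 := by nlinarith
        have h5 : (1 + T) ^ 2 ≤ (1 + T) ^ 2 * (1 + T ^ 2) := by
          nlinarith [mul_nonneg (sq_nonneg (1 + T)) (sq_nonneg T)]
        gcongr ?_ * _ + ?_ * _
        · linarith
        · gcongr
    _ = _ := by rw [mixedBound]; ring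

theorem continuous_mixedSol (μ : ℝ) : Continuous fun t => mixedSol T f Φ t μ :=
  ((continuous_dirichletCoeff T μ).smul continuous_const).add
    ((continuous_neumannCoeff T μ).smul continuous_const)

theorem continuous_mixedSol' (μ : ℝ) : Continuous fun t => mixedSol' T f Φ t μ :=
  ((continuous_dirichletCoeff' T μ).smul continuous_const).add
    ((continuous_neumannCoeff' T μ).smul continuous_const)

theorem hasDerivAt_inner_mixedSol (μ t : ℝ) (x : H) :
    HasDerivAt (fun t => inner ℝ (mixedSol T f Φ t μ) x) (inner ℝ (mixedSol' T f Φ t μ) x) t := by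
  simp only [mixedSol, mixedSol', inner_add_left, real_inner_smul_left]
  exact ((hasDerivAt_dirichletCoeff T μ t).mul_const _).add
    ((hasDerivAt_neumannCoeff T μ t).mul_const _)

theorem hasDerivAt_inner_mixedSol' (μ t : ℝ) (x : H) :
    HasDerivAt (fun t => inner ℝ (mixedSol' T f Φ t μ) x)
      (μ ^ 2 * inner ℝ (mixedSol T f Φ t μ) x) t := by
  simp only [mixedSol, mixedSol', inner_add_left, real_inner_smul_left]
  refine (((hasDerivAt_dirichletCoeff' T μ t).mul_const _).add
    ((hasDerivAt_neumannCoeff' T μ t).mul_const _)).congr_deriv ?_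
  ring

theorem abs_inner_le_add_sq (x y : H) : |inner ℝ x y| ≤ ‖x‖ ^ 2 + ‖y‖ ^ 2 := by
  nlinarith [abs_real_inner_le_norm x y, sq_nonneg (‖x‖ - ‖y‖), sq_nonneg ‖x‖, sq_nonneg ‖y‖]

theorem IsTest.exists_abs_le {η : ℝ → ℝ} (hη : IsTest T η) : ∃ M, 0 ≤ M ∧ ∀ t, |η t| ≤ M := by
  obtain ⟨M, hM⟩ := hη.1.continuous.bounded_above_of_compact_support hη.2.1
  exact ⟨M, (norm_nonneg _).trans (hM 0), hM⟩

end MixedProblem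

/-! ### Existence for the mixed problem -/

section Existence

variable {H : Type*} [NormedAddCommGroup H] [InnerProductSpace ℝ H]
  {A : H →ₗ.[ℝ] H} {T : ℝ} {f Φ : ℝ → H}

theorem mixedSol_mem (hf : ∀ μ, f μ ∈ eigenspace A μ) (hΦ : ∀ μ, Φ μ ∈ eigenspace A μ)
    (t μ : ℝ) : mixedSol T f Φ t μ ∈ eigenspace A μ :=
  Submodule.add_mem _ (Submodule.smul_mem _ _ (hf μ)) (Submodule.smul_mem _ _ (hΦ μ))

theorem mixedSol'_mem (hf : ∀ μ, f μ ∈ eigenspace A μ) (hΦ : ∀ μ, Φ μ ∈ eigenspace A μ)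
    (t μ : ℝ) : mixedSol' T f Φ t μ ∈ eigenspace A μ :=
  Submodule.add_mem _ (Submodule.smul_mem _ _ (hf μ)) (Submodule.smul_mem _ _ (hΦ μ))

variable [CompleteSpace H]

theorem rpow_half_eq_sqrt (μ : ℝ) : (1 + μ ^ 2) ^ ((1 : ℝ) / 2) = √(1 + μ ^ 2) :=
  (Real.sqrt_eq_rpow _).symm

theorem rpow_neg_half_eq_inv_sqrt (μ : ℝ) :
    (1 + μ ^ 2) ^ (-((1 : ℝ) / 2)) = (√(1 + μ ^ 2))⁻¹ := by
  rw [Real.rpow_neg (by positivity), rpow_half_eq_sqrt]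

theorem eigenProj_apply_eq (hsa : IsSelfAdjoint A) (hA : OrthogonalEigenspaces A) (μ : ℝ)
    (ψ : A.domain) : eigenProj A μ (A ψ) = μ • eigenProj A μ ψ := by
  refine ext_inner_right ℝ fun y => ?_
  obtain ⟨h, hy⟩ := hA.eigenProj_mem μ y
  rw [inner_eigenProj_left, real_inner_smul_left, inner_eigenProj_left]
  have := inner_apply_left_of_isSelfAdjoint hsa ψ ⟨_, h⟩
  rw [hy, real_inner_smul_right] at this
  exact this

theorem inner_eigenProj_right_of_mem {μ : ℝ} {x : H} (hx : x ∈ eigenspace A μ) (y : H) :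
    inner ℝ x (eigenProj A μ y) = inner ℝ x y := by
  rw [← inner_eigenProj_left, OrthogonalEigenspaces.eigenProj_eq_self hx]

/-- The components of an element of `ℋ^{-1/2}`. -/
theorem exists_components (hA : OrthogonalEigenspaces A) (φ : HsNeg A (1 / 2)) :
    ∃ Φ : ℝ → H, (∀ μ, Φ μ ∈ eigenspace A μ) ∧
      (Summable fun μ => (√(1 + μ ^ 2))⁻¹ * ‖Φ μ‖ ^ 2) ∧
      ∀ (μ : ℝ) (ψ : Hs A (1 / 2)), Hs.toH ψ ∈ eigenspace A μ →
        φ ψ = inner ℝ (Φ μ) (Hs.toH ψ) := by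
  obtain ⟨F, hF⟩ := Hs.exists_inner_parts_eq φ
  -- The weight (1 + μ²)^(1/4) of `parts` moves from the test element onto `F`; the projection is
  -- needed since the coordinates of `F` need not be eigenvectors.
  refine ⟨fun μ => (1 + μ ^ 2) ^ ((1 / 2 : ℝ) / 2) • eigenProj A μ (F μ),
    fun μ => Submodule.smul_mem _ _ (hA.eigenProj_mem μ _), ?_, fun μ ψ hψ => ?_⟩
  · refine (Hs.memℓp_two_iff.1 F.2).of_nonneg_of_le (fun μ => by positivity) fun μ => ?_
    rw [Hs.norm_rpow_smul_sq, rpow_half_eq_sqrt, inv_mul_cancel_left₀ (by positivity)]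
    gcongr
    exact Submodule.norm_starProjection_apply_le _ _
  · rw [hF, ← (lp.hasSum_inner F (Hs.partsLI ψ)).tsum_eq, tsum_eq_single μ fun ν hν => ?_]
    · rw [Hs.partsLI_apply, Hs.parts_apply, OrthogonalEigenspaces.eigenProj_eq_self hψ,
        real_inner_smul_right, real_inner_smul_left, inner_eigenProj_left,
        OrthogonalEigenspaces.eigenProj_eq_self hψ]
    · rw [Hs.partsLI_apply, Hs.parts_apply, hA.eigenProj_eq_zero hν hψ, smul_zero, inner_zero_right]

theorem exists_mixed_trace_path (hA : OrthogonalEigenspaces A)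
    (hf : ∀ μ, f μ ∈ eigenspace A μ) (hΦ : ∀ μ, Φ μ ∈ eigenspace A μ)
    (hB : Summable (mixedBound T f Φ)) :
    ∃ U : ℝ → Hs A (1 / 2), ContinuousOn U (Icc 0 T) ∧
      ∀ t ∈ Icc 0 T, ∀ μ, eigenProj A μ (Hs.toH (U t)) = mixedSol T f Φ t μ := by
  -- The bounds hold on [0, T] only; elsewhere the path takes the default value 0.
  have h1 : ∀ t, ∃ x : Hs A (1 / 2), t ∈ Icc 0 T →
      ∀ μ, eigenProj A μ (Hs.toH x) = mixedSol T f Φ t μ := fun t => by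
    by_cases ht : t ∈ Icc 0 T
    · obtain ⟨x, hx⟩ := Hs.exists_eigenProj_eq hA (s := 1 / 2) (by norm_num) (mixedSol_mem hf hΦ t)
        (hB.of_nonneg_of_le (fun _ => by positivity) fun μ => by
          rw [rpow_half_eq_sqrt]; exact sqrt_mul_norm_mixedSol_sq_le ht μ)
      exact ⟨x, fun _ => hx⟩
    · exact ⟨0, fun h => absurd h ht⟩
  choose U hU using h1
  refine ⟨U, ?_, hU⟩
  have h2 : ∀ t ∈ Icc 0 T, ∀ μ, Hs.partsLI (U t) μ =
      (1 + μ ^ 2) ^ ((1 / 2 : ℝ) / 2) • mixedSol T f Φ t μ := fun t ht μ => by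
    rw [Hs.partsLI_apply, Hs.parts_apply, hU t ht]
  have h3 : ContinuousOn (fun t => Hs.partsLI (U t)) (Icc 0 T) := by
    refine continuousOn_lp (b := fun μ => √(mixedBound T f Φ μ)) ?_ (fun μ => ?_)
      fun t ht μ => ?_
    · simpa only [Real.sq_sqrt (mixedBound_nonneg _)] using hB
    · refine ContinuousOn.congr ?_ fun t ht => h2 t ht μ
      exact ((continuous_mixedSol μ).const_smul _).continuousOn
    · refine Real.le_sqrt_of_sq_le ?_
      rw [h2 t ht, Hs.norm_rpow_smul_sq, rpow_half_eq_sqrt]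
      exact sqrt_mul_norm_mixedSol_sq_le ht μ
  exact (Hs.partsLI (A := A) (s := 1 / 2)).isometry.isUniformInducing.isInducing.continuousOn_iff.2
    h3

theorem exists_mixed_deriv_path (hf : ∀ μ, f μ ∈ eigenspace A μ)
    (hΦ : ∀ μ, Φ μ ∈ eigenspace A μ) (hB : Summable (mixedBound T f Φ)) :
    ∃ p : ℝ → HsNeg A (1 / 2), ContinuousOn p (Icc 0 T) ∧
      ∀ t ∈ Icc 0 T, ∀ ψ : Hs A (1 / 2),
        HasSum (fun μ => inner ℝ (mixedSol' T f Φ t μ) (Hs.toH ψ)) (p t ψ) := by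
  -- The exponent -1/4 cancels the 1/4 in `parts`, so `functional` applied to this family is the
  -- unweighted pairing.
  set d : ℝ → ℝ → H := fun t μ => (1 + μ ^ 2) ^ ((-(1 / 2 : ℝ)) / 2) • mixedSol' T f Φ t μ with hd
  have h0 : ∀ t ∈ Icc 0 T, ∀ μ, ‖d t μ‖ ^ 2 ≤ mixedBound T f Φ μ := fun t ht μ => by
    rw [hd, Hs.norm_rpow_smul_sq, rpow_neg_half_eq_inv_sqrt]
    exact inv_sqrt_mul_norm_mixedSol'_sq_le ht μ
  have h1 : ∀ t, ∃ x : lp (fun _ : ℝ => H) 2, t ∈ Icc 0 T → ∀ μ, x μ = d t μ := fun t => by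
    by_cases ht : t ∈ Icc 0 T
    · exact ⟨⟨d t, Hs.memℓp_two_iff.2 (hB.of_nonneg_of_le (fun _ => by positivity) (h0 t ht))⟩,
        fun _ _ => rfl⟩
    · exact ⟨0, fun h => absurd h ht⟩
  choose G hG using h1
  have h3 : ContinuousOn G (Icc 0 T) := by
    refine continuousOn_lp (b := fun μ => √(mixedBound T f Φ μ)) ?_ (fun μ => ?_)
      fun t ht μ => ?_
    · simpa only [Real.sq_sqrt (mixedBound_nonneg _)] using hB
    · refine ContinuousOn.congr ?_ fun t ht => hG t ht μ
      exact ((continuous_mixedSol' μ).const_smul _).continuousOn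
    · refine Real.le_sqrt_of_sq_le ?_
      rw [hG t ht]
      exact h0 t ht μ
  refine ⟨fun t => Hs.functional (G t), Hs.functional.continuous.comp_continuousOn h3,
    fun t ht ψ => ?_⟩
  rw [Hs.functional_apply]
  refine (lp.hasSum_inner (G t) (Hs.partsLI ψ)).congr_fun fun μ => ?_
  rw [hG t ht, Hs.partsLI_apply, Hs.parts_apply, hd, real_inner_smul_left, real_inner_smul_right,
    inner_eigenProj_right_of_mem (mixedSol'_mem hf hΦ t μ), ← mul_assoc,
    ← Real.rpow_add (by positivity)]
  norm_num

theorem exists_mixed_memLp (hA : OrthogonalEigenspaces A) (hT : 0 < T)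
    (hf : ∀ μ, f μ ∈ eigenspace A μ) (hΦ : ∀ μ, Φ μ ∈ eigenspace A μ)
    (hB : Summable (mixedBound T f Φ)) :
    ∃ u : ℝ → Hs A 1, MemLp u 2 (volume.restrict (Ioo 0 T)) ∧
      ∀ᵐ t ∂(volume.restrict (Ioo 0 T)), ∀ μ,
        eigenProj A μ (Hs.toH (u t)) = mixedSol T f Φ t μ := by
  set a : ℝ → ℝ → H := fun t μ => (1 + μ ^ 2) ^ ((1 : ℝ) / 2) • mixedSol T f Φ t μ with ha
  have hN : (Function.support (mixedBound T f Φ)).Countable := hB.countable_support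
  have hc : ∀ μ, Continuous fun t => a t μ := fun μ => (continuous_mixedSol μ).const_smul _
  have h0 : ∀ t, ∀ μ ∉ Function.support (mixedBound T f Φ), a t μ = 0 := fun t μ hμ => by
    obtain ⟨h1, h2⟩ := eq_zero_of_mixedBound_eq_zero hT (Function.notMem_support.1 hμ)
    simp [ha, mixedSol, h1, h2]
  have hint := lintegral_norm_mixedSol_sq_le (f := f) (Φ := Φ) hT
  have hs := ae_summable_norm_sq hN hB hc h0 hint
  -- The components define an element of ℋ¹ for almost every `t`; at the exceptional times `u` may
  -- be set to 0.
  have h1 : ∀ t, ∃ x : Hs A 1, (Summable fun μ => ‖a t μ‖ ^ 2) →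
      ∀ μ, eigenProj A μ (Hs.toH x) = mixedSol T f Φ t μ := fun t => by
    by_cases ht : Summable fun μ => ‖a t μ‖ ^ 2
    · obtain ⟨x, hx⟩ := Hs.exists_eigenProj_eq hA (s := 1) zero_le_one (mixedSol_mem hf hΦ t)
        (by simpa only [ha, Hs.norm_rpow_smul_sq] using ht)
      exact ⟨x, fun _ => hx⟩
    · exact ⟨0, fun h => absurd h ht⟩
  choose u hu using h1
  have hae : ∀ᵐ t ∂(volume.restrict (Ioo 0 T)), ∀ μ,
      eigenProj A μ (Hs.toH (u t)) = mixedSol T f Φ t μ := hs.mono hu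
  refine ⟨u, ?_, hae⟩
  refine MemLp.of_comp_antilipschitzWith (g := Hs.partsLI (A := A) (s := 1)) ?_
    (Hs.partsLI (A := A) (s := 1)).isometry.isUniformInducing.uniformContinuous
    (Hs.partsLI (A := A) (s := 1)).antilipschitz (map_zero _)
  refine memLp_two_of_components hN hB hc h0 hint (hae.mono fun t ht μ => ?_)
  rw [Function.comp_apply, Hs.partsLI_apply, Hs.parts_apply, ht]

/-- Reduces distributional identities for `u` to single components. The majorant comes from |⟨a, b⟩|
≤ ‖a‖² + ‖b‖², with Bessel's inequality for `x`. -/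
theorem hasSum_setIntegral_inner_mixedSol (hA : OrthogonalEigenspaces A)
    (hf : ∀ μ, f μ ∈ eigenspace A μ) (hΦ : ∀ μ, Φ μ ∈ eigenspace A μ)
    (hB : Summable (mixedBound T f Φ)) {u : ℝ → Hs A 1}
    (hu : ∀ᵐ t ∂(volume.restrict (Ioo 0 T)), ∀ μ,
      eigenProj A μ (Hs.toH (u t)) = mixedSol T f Φ t μ) {η : ℝ → ℝ} (hη : IsTest T η) (x : H) :
    HasSum (fun μ => ∫ t in Ioo 0 T, η t * inner ℝ (mixedSol T f Φ t μ) x)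
      (∫ t in Ioo 0 T, η t * inner ℝ (Hs.toH (u t)) x) := by
  obtain ⟨M, hM0, hM⟩ := hη.exists_abs_le
  refine hasSum_setIntegral (B := fun μ => M * (mixedBound T f Φ μ + ‖eigenProj A μ x‖ ^ 2))
    ((hB.add (hA.summable_norm_sq_eigenProj x)).mul_left M)
    (fun μ => hη.1.continuous.mul ((continuous_mixedSol μ).inner continuous_const))
    (fun t ht μ => ?_) (hu.mono fun t ht => ?_)
  · rw [abs_mul]
    gcongr
    · exact hM t
    · rw [← inner_eigenProj_right_of_mem (mixedSol_mem hf hΦ t μ)]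
      refine (abs_inner_le_add_sq _ _).trans ?_
      gcongr
      refine le_trans ?_ (sqrt_mul_norm_mixedSol_sq_le (Ioo_subset_Icc_self ht) μ)
      exact le_mul_of_one_le_left (by positivity)
        (Real.one_le_sqrt.2 (le_add_of_nonneg_right (sq_nonneg μ)))
  · refine ((Hs.hasSum_inner (u t) x).mul_left (η t)).congr_fun fun μ => ?_
    rw [ht, inner_eigenProj_right_of_mem (mixedSol_mem hf hΦ t μ)]

theorem hasSum_setIntegral_inner_mixedSol'
    (hf : ∀ μ, f μ ∈ eigenspace A μ) (hΦ : ∀ μ, Φ μ ∈ eigenspace A μ)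
    (hB : Summable (mixedBound T f Φ)) {p : ℝ → HsNeg A (1 / 2)} {ψ : Hs A (1 / 2)}
    (hp : ∀ t ∈ Icc 0 T, HasSum (fun μ => inner ℝ (mixedSol' T f Φ t μ) (Hs.toH ψ)) (p t ψ))
    {η : ℝ → ℝ} (hη : IsTest T η) :
    HasSum (fun μ => ∫ t in Ioo 0 T, η t * inner ℝ (mixedSol' T f Φ t μ) (Hs.toH ψ))
      (∫ t in Ioo 0 T, η t * p t ψ) := by
  obtain ⟨M, hM0, hM⟩ := hη.exists_abs_le
  refine hasSum_setIntegral (B := fun μ => M * (mixedBound T f Φ μ +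
      (1 + μ ^ 2) ^ ((1 : ℝ) / 2) * ‖eigenProj A μ (Hs.toH ψ)‖ ^ 2))
    ((hB.add (Hs.summable_parts ψ)).mul_left M)
    (fun μ => hη.1.continuous.mul ((continuous_mixedSol' μ).inner continuous_const))
    (fun t ht μ => ?_) ?_
  · rw [abs_mul]
    gcongr
    · exact hM t
    · rw [← inner_eigenProj_right_of_mem (mixedSol'_mem hf hΦ t μ)]
      -- Splitting the weight as (1 + μ²)^(-1/4) and (1 + μ²)^(1/4) leaves the pairing unchanged and
      -- makes both factors square summable.
      have h1 := abs_inner_le_add_sq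
        ((1 + μ ^ 2) ^ ((-(1 / 2 : ℝ)) / 2) • mixedSol' T f Φ t μ)
        ((1 + μ ^ 2) ^ ((1 / 2 : ℝ) / 2) • eigenProj A μ (Hs.toH ψ))
      rw [Hs.norm_rpow_smul_sq, Hs.norm_rpow_smul_sq, real_inner_smul_left, real_inner_smul_right,
        ← mul_assoc, ← Real.rpow_add (by positivity), rpow_neg_half_eq_inv_sqrt] at h1
      norm_num at h1
      norm_num
      refine h1.trans ?_
      gcongr
      exact inv_sqrt_mul_norm_mixedSol'_sq_le (Ioo_subset_Icc_self ht) μ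
  · filter_upwards [ae_restrict_mem measurableSet_Ioo] with t ht
    exact (hp t (Ioo_subset_Icc_self ht)).mul_left (η t)

/-- The mixed problem `u(0) = f`, `∂_t u(T) = φ` has a solution in `V_e`, with explicit
`∂_t u(0)`. -/
theorem exists_mixed_solution (hsa : IsSelfAdjoint A) (hA : OrthogonalEigenspaces A) (hT : 0 < T)
    (f : Hs A (1 / 2)) (φ : HsNeg A (1 / 2)) :
    ∃ (u : ℝ → Hs A 1) (g : HsNeg A (1 / 2)), SolvesCauchy A T f g u ∧
      ∀ (μ : ℝ) (ψ : Hs A (1 / 2)), Hs.toH ψ ∈ eigenspace A μ →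
        Real.cosh (μ * T) * g ψ =
          φ ψ - μ * Real.sinh (μ * T) * inner ℝ (Hs.toH f) (Hs.toH ψ) := by
  obtain ⟨Φ, hΦ, hΦs, hΦe⟩ := exists_components hA φ
  set F : ℝ → H := fun μ => eigenProj A μ (Hs.toH f) with hFdef
  have hF : ∀ μ, F μ ∈ eigenspace A μ := fun μ => hA.eigenProj_mem μ _
  have hFs : Summable fun μ => √(1 + μ ^ 2) * ‖F μ‖ ^ 2 := by
    simpa only [rpow_half_eq_sqrt] using Hs.summable_parts f
  have hB : Summable (mixedBound T F Φ) := summable_mixedBound hFs hΦs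
  obtain ⟨U, hUc, hU⟩ := exists_mixed_trace_path hA hF hΦ hB
  obtain ⟨p, hpc, hp⟩ := exists_mixed_deriv_path hF hΦ hB
  obtain ⟨u, hum, hu⟩ := exists_mixed_memLp hA hT hF hΦ hB
  have h0 : (0 : ℝ) ∈ Icc 0 T := left_mem_Icc.2 hT.le
  refine ⟨u, p 0, ⟨⟨hum, fun η hη ψ hψ => ?_⟩, ⟨U, hUc, ?_, ?_⟩, ⟨p, hpc, fun η hη ψ => ?_, rfl⟩⟩,
    fun μ ψ hψ => ?_⟩
  -- Componentwise, two integrations by parts produce the factor μ², and `eigenProj_apply_eq` used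
  -- twice produces the same factor from A²ψ.
  · have hη2 : IsTest T (iteratedDeriv 2 η) := by
      rw [iteratedDeriv_succ, iteratedDeriv_one]; exact hη.deriv.deriv
    refine (hasSum_setIntegral_inner_mixedSol hA hF hΦ hB hu hη2 ψ).unique ?_
    refine (hasSum_setIntegral_inner_mixedSol hA hF hΦ hB hu hη (A ⟨A ψ, hψ⟩)).congr_fun
      fun μ => ?_
    rw [iteratedDeriv_succ, iteratedDeriv_one, hη.deriv.setIntegral_deriv_mul
      (fun t => hasDerivAt_inner_mixedSol μ t _) ((continuous_mixedSol' μ).inner continuous_const),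
      hη.setIntegral_deriv_mul (fun t => hasDerivAt_inner_mixedSol' μ t _)
      (continuous_const.mul ((continuous_mixedSol μ).inner continuous_const)), neg_neg]
    refine integral_congr_ae (.of_forall fun t => ?_)
    have hm := mixedSol_mem (T := T) hF hΦ t μ
    simp only
    rw [← inner_eigenProj_right_of_mem hm (A ⟨A ψ, hψ⟩), eigenProj_apply_eq hsa hA,
      eigenProj_apply_eq hsa hA, real_inner_smul_right, real_inner_smul_right,
      inner_eigenProj_right_of_mem hm]
    ring
  · filter_upwards [hu, ae_restrict_mem measurableSet_Ioo] with t h1 ht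
    exact Hs.toH_eq_of_eigenProj fun μ => by rw [h1, hU t (Ioo_subset_Icc_self ht)]
  · refine Hs.ext_eigenProj fun μ => ?_
    rw [hU 0 h0]
    simp [mixedSol, dirichletCoeff, neumannCoeff, sinhKernel, hFdef, (Real.cosh_pos _).ne']
  · refine (hasSum_setIntegral_inner_mixedSol hA hF hΦ hB hu hη.deriv _).unique ?_
    refine (hasSum_setIntegral_inner_mixedSol' hF hΦ hB (fun t ht => hp t ht ψ)
      hη).neg.congr_fun fun μ => ?_
    exact hη.setIntegral_deriv_mul (fun t => hasDerivAt_inner_mixedSol μ t _)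
      ((continuous_mixedSol' μ).inner continuous_const)
  · have h1 : p 0 ψ = inner ℝ (mixedSol' T F Φ 0 μ) (Hs.toH ψ) := by
      refine (hp 0 h0 ψ).unique (hasSum_single μ fun ν hν => ?_)
      rw [← inner_eigenProj_right_of_mem (mixedSol'_mem hF hΦ 0 ν), hA.eigenProj_eq_zero hν hψ,
        inner_zero_right]
    have hc := (Real.cosh_pos (μ * T)).ne'
    rw [h1, hΦe μ ψ hψ, mixedSol', inner_add_left, real_inner_smul_left, real_inner_smul_left,
      hFdef, inner_eigenProj_left, OrthogonalEigenspaces.eigenProj_eq_self hψ, dirichletCoeff',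
      neumannCoeff']
    field_simp
    simp
    ring

end Existence

/-! ### Traces of solutions on eigenvectors -/

section Traces

variable {H : Type*} [NormedAddCommGroup H] [InnerProductSpace ℝ H] [CompleteSpace H]
  {A : H →ₗ.[ℝ] H} {T : ℝ} {u : ℝ → Hs A 1}

/-- `HasTrace` quantifies over the continuous path, so traces at 0 and at `T` may come with
different paths; this identifies them, as `eqOn_of_deriv_paths` does for the derivative. -/
theorem eqOn_of_trace_paths (hT : 0 < T) {U V : ℝ → Hs A (1 / 2)} (hU : ContinuousOn U (Icc 0 T))
    (hV : ContinuousOn V (Icc 0 T))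
    (hUu : ∀ᵐ t ∂(volume.restrict (Ioo 0 T)), Hs.toH (U t) = Hs.toH (u t))
    (hVu : ∀ᵐ t ∂(volume.restrict (Ioo 0 T)), Hs.toH (V t) = Hs.toH (u t)) :
    EqOn U V (Icc 0 T) := by
  refine eqOn_of_ae_eq hT hU hV ?_
  filter_upwards [hUu, hVu] with t h1 h2
  exact Subtype.ext (h1.trans h2.symm)

theorem eqOn_of_deriv_paths (hT : 0 < T) {p q : ℝ → HsNeg A (1 / 2)}
    (hp : ContinuousOn p (Icc 0 T)) (hq : ContinuousOn q (Icc 0 T))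
    (hpu : ∀ η : ℝ → ℝ, IsTest T η → ∀ ψ : Hs A (1 / 2),
      ∫ t in Ioo 0 T, deriv η t * inner ℝ (Hs.toH (u t)) (Hs.toH ψ) =
        -∫ t in Ioo 0 T, η t * p t ψ)
    (hqu : ∀ η : ℝ → ℝ, IsTest T η → ∀ ψ : Hs A (1 / 2),
      ∫ t in Ioo 0 T, deriv η t * inner ℝ (Hs.toH (u t)) (Hs.toH ψ) =
        -∫ t in Ioo 0 T, η t * q t ψ) :
    EqOn p q (Icc 0 T) := by
  intro t ht
  ext ψ
  exact eqOn_of_forall_test (Y := fun t => p t ψ) (Z := fun t => q t ψ) hT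
    (hp.clm_apply continuousOn_const) (hq.clm_apply continuousOn_const)
    (fun η hη => neg_injective ((hpu η hη ψ).symm.trans (hqu η hη ψ))) ht

/-- Pairing with an eigenvector reads a single coordinate of `parts`, so it is represented by
`lp.single` with the weight inverted. -/
theorem continuous_inner_toH {s μ : ℝ} {x : H} (hx : x ∈ eigenspace A μ) :
    Continuous fun φ : Hs A s => inner ℝ (Hs.toH φ) x := by
  have h : ∀ φ : Hs A s, inner ℝ (Hs.toH φ) x =
      Hs.functional (lp.single (E := fun _ : ℝ => H) 2 μ (((1 + μ ^ 2) ^ (s / 2))⁻¹ • x)) φ :=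
    fun φ => by
      have h1 : (1 + μ ^ 2) ^ (s / 2) ≠ 0 := (Real.rpow_pos_of_pos (by positivity) _).ne'
      rw [Hs.functional_apply, lp.inner_single_left, Hs.partsLI_apply, Hs.parts_apply,
        real_inner_smul_left, real_inner_smul_right, inv_mul_cancel_left₀ h1,
        inner_eigenProj_right_of_mem hx, real_inner_comm]
  simp only [h]
  exact ContinuousLinearMap.continuous _

/-- The relations between the traces of an element of `V_e` at `0` and at `T`, tested on an
eigenvector. -/
theorem MemVe.cauchy_data (hu : MemVe A T u) (hT : 0 < T) {f₀ f₁ : Hs A (1 / 2)}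
    {g₀ g₁ : HsNeg A (1 / 2)} (hf₀ : HasTrace A T u 0 f₀) (hf₁ : HasTrace A T u T f₁)
    (hg₀ : HasDerivTrace A T u 0 g₀) (hg₁ : HasDerivTrace A T u T g₁) {μ : ℝ} {ψ : Hs A (1 / 2)}
    (hψ : Hs.toH ψ ∈ eigenspace A μ) :
    g₁ ψ * Real.cosh (μ * T) - μ * inner ℝ (Hs.toH f₁) (Hs.toH ψ) * Real.sinh (μ * T) = g₀ ψ ∧
      μ * inner ℝ (Hs.toH f₁) (Hs.toH ψ) * Real.cosh (μ * T) - g₁ ψ * Real.sinh (μ * T) =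
        μ * inner ℝ (Hs.toH f₀) (Hs.toH ψ) := by
  obtain ⟨U, hU, hUu, rfl⟩ := hf₀
  obtain ⟨V, hV, hVu, rfl⟩ := hf₁
  obtain ⟨p, hp, hpu, rfl⟩ := hg₀
  obtain ⟨q, hq, hqu, rfl⟩ := hg₁
  have hTm : T ∈ Icc 0 T := right_mem_Icc.2 hT.le
  rw [← eqOn_of_trace_paths hT hU hV hUu hVu hTm, ← eqOn_of_deriv_paths hT hp hq hpu hqu hTm]
  have hcongr : ∀ (η : ℝ → ℝ) (x : H), ∫ t in Ioo 0 T, η t * inner ℝ (Hs.toH (U t)) x =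
      ∫ t in Ioo 0 T, η t * inner ℝ (Hs.toH (u t)) x := fun η x =>
    integral_congr_ae (hUu.mono fun t ht => by simp only [ht])
  refine cauchy_data_of_weak_ode (Y := fun t => inner ℝ (Hs.toH (U t)) (Hs.toH ψ))
    (p := fun t => p t ψ) hT μ ((continuous_inner_toH hψ).comp_continuousOn hU)
    (hp.clm_apply continuousOn_const) (fun η hη => ?_) fun η hη => ?_
  · rw [hcongr, hpu η hη]
  · obtain ⟨hx, hAx⟩ := hψ
    -- An eigenvector lies in dom A² with A²ψ = μ²ψ, so it is an admissible test vector in V_e.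
    have h1 : A ⟨Hs.toH ψ, hx⟩ ∈ A.domain := by
      rw [hAx]; exact A.domain.smul_mem μ hx
    have h2 : A ⟨A ⟨Hs.toH ψ, hx⟩, h1⟩ = μ ^ 2 • Hs.toH ψ := by
      have h3 : (⟨A ⟨Hs.toH ψ, hx⟩, h1⟩ : A.domain) = μ • ⟨Hs.toH ψ, hx⟩ := Subtype.ext hAx
      rw [h3, A.map_smul, hAx, smul_smul, pow_two]
    have h4 := hu.2 η hη ⟨Hs.toH ψ, hx⟩ h1
    rw [h2] at h4
    simp only [real_inner_smul_right] at h4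
    rw [hcongr, h4]
    exact integral_congr_ae (hUu.mono fun t ht => by simp only [ht])

/-- One step of the iteration, tested on an eigenvector. -/
theorem IsStep.apply_eigenvector (hT : 0 < T) {f : Hs A (1 / 2)} {g φ φ' : HsNeg A (1 / 2)}
    (h : IsStep A T f g φ φ') {μ : ℝ} {ψ : Hs A (1 / 2)} (hψ : Hs.toH ψ ∈ eigenspace A μ) :
    Real.cosh (μ * T) ^ 2 * φ' ψ = Real.cosh (μ * T) * g ψ +
      μ * Real.sinh (μ * T) * inner ℝ (Hs.toH f) (Hs.toH ψ) + Real.sinh (μ * T) ^ 2 * φ ψ := by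
  obtain ⟨v, w, h, ⟨hv, hv0, hv1⟩, hvT, ⟨hw, hw0, hwT⟩, hw1⟩ := h
  -- The traces ∂_t v(0) and w(0), not prescribed by the step, are read from the paths; the two
  -- relations selected below do not involve them.
  obtain ⟨p, hp, hpv, hpT⟩ := id hv1
  obtain ⟨U, hU, hUw, hUT⟩ := id hwT
  have h1 := (hv.cauchy_data hT hv0 hvT ⟨p, hp, hpv, rfl⟩ hv1 hψ).2
  have h2 := (hw.cauchy_data hT ⟨U, hU, hUw, rfl⟩ hwT hw0 hw1 hψ).1
  linear_combination Real.cosh (μ * T) * h2 + Real.sinh (μ * T) * h1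

/-- In the limit the recursion becomes a fixed-point equation, which cosh² - sinh² = 1 solves
explicitly. Convergence of φ_k tested on ψ suffices. -/
theorem limit_apply_eigenvector (hT : 0 < T) {f : Hs A (1 / 2)} {g φbar : HsNeg A (1 / 2)}
    {φ : ℕ → HsNeg A (1 / 2)} (hφ : IsIterate A T f g φ) (hconv : Tendsto φ atTop (𝓝 φbar))
    {μ : ℝ} {ψ : Hs A (1 / 2)} (hψ : Hs.toH ψ ∈ eigenspace A μ) :
    φbar ψ = Real.cosh (μ * T) * g ψ +
      μ * Real.sinh (μ * T) * inner ℝ (Hs.toH f) (Hs.toH ψ) := by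
  have h1 : Tendsto (fun k => φ k ψ) atTop (𝓝 (φbar ψ)) :=
    ((ContinuousLinearMap.apply ℝ ℝ ψ).continuous.tendsto φbar).comp hconv
  have h2 := (h1.comp (tendsto_add_atTop_nat 1)).const_mul (Real.cosh (μ * T) ^ 2)
  have h3 := (h1.const_mul (Real.sinh (μ * T) ^ 2)).const_add (Real.cosh (μ * T) * g ψ +
      μ * Real.sinh (μ * T) * inner ℝ (Hs.toH f) (Hs.toH ψ))
  have h4 := tendsto_nhds_unique h2 (h3.congr fun k => ((hφ k).apply_eigenvector hT hψ).symm)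
  linear_combination h4 - φbar ψ * Real.cosh_sq (μ * T)

end Traces

end EllipticCauchy

end

/-! ### Consistency and the trace at `T` -/

theorem mainTheorem7 {H : Type*} [NormedAddCommGroup H] [InnerProductSpace ℝ H] [CompleteSpace H]
    (A : H →ₗ.[ℝ] H) (hA_sa : IsSelfAdjoint A) (hA_pos : EllipticCauchy.IsPositive A)
    (hA_disc : EllipticCauchy.HasDiscreteSpectrum A) (T : ℝ) (hT : 0 < T)
    (f : EllipticCauchy.Hs A (1 / 2)) (g : EllipticCauchy.HsNeg A (1 / 2))
    (φ : ℕ → EllipticCauchy.HsNeg A (1 / 2)) (hφ : EllipticCauchy.IsIterate A T f g φ)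
    (φbar : EllipticCauchy.HsNeg A (1 / 2)) (hconv : Tendsto φ atTop (𝓝 φbar)) :
    EllipticCauchy.IsConsistent A T f g ∧
      ∀ u : ℝ → EllipticCauchy.Hs A 1, EllipticCauchy.SolvesCauchy A T f g u →
        EllipticCauchy.HasDerivTrace A T u T φbar := by
  have hA := EllipticCauchy.orthogonalEigenspaces hA_sa hA_disc
  have hlim := fun (μ : ℝ) (ψ : EllipticCauchy.Hs A (1 / 2))
    (hψ : EllipticCauchy.Hs.toH ψ ∈ EllipticCauchy.eigenspace A μ) =>
      EllipticCauchy.limit_apply_eigenvector hT hφ hconv hψ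
  refine ⟨?_, fun u hu => ?_⟩
  -- The candidate solves the mixed problem with final slope φbar; the formula for φbar forces its
  -- initial slope to be g.
  · obtain ⟨u, g', hu, hg'⟩ := EllipticCauchy.exists_mixed_solution hA_sa hA hT f φbar
    have hgg : g' = g := EllipticCauchy.Hs.functional_ext hA (by norm_num) fun μ ψ hψ => by
      refine mul_left_cancel₀ (Real.cosh_pos (μ * T)).ne' ?_
      rw [hg' μ ψ hψ, hlim μ ψ hψ]
      ring
    exact ⟨u, hgg ▸ hu⟩
  · obtain ⟨hVe, hf, hg⟩ := hu
    obtain ⟨U, hU, hUu, hU0⟩ := id hf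
    obtain ⟨p, hp, hpu, hp0⟩ := id hg
    refine ⟨p, hp, hpu, EllipticCauchy.Hs.functional_ext hA (by norm_num) fun μ ψ hψ => ?_⟩
    -- The traces at `T` are the endpoint values of the paths given at 0. Eliminating `U T` from the
    -- two relations expresses `p T` through f and g.
    obtain ⟨h1, h2⟩ := hVe.cauchy_data hT hf ⟨U, hU, hUu, rfl⟩ hg ⟨p, hp, hpu, rfl⟩ hψ
    rw [hlim μ ψ hψ]
    linear_combination Real.cosh (μ * T) * h1 + Real.sinh (μ * T) * h2 -
      p T ψ * Real.cosh_sq (μ * T)
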